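/- \textbf{Conventions.} A (countable) field is regarded as a structure in the finite language $\{+,\cdot,-,{}^{-1},0,1\}$ (with $0^{-1}=0$) whose universe is a subset of $\omega$, or an isomorphic copy of such a structure. The degree of such a structure is the Turing degree of its atomic diagram, and it is computable if its atomic diagram is; $\mathcal A\le_T X$ means that the atomic diagram of $\mathcal A$ is Turing reducible to $X$. The isomorphism type of a countable field $\mathcal A$ has Turing degree $\mathbf d$ if $\mathbf d$ is the least element of $\{\deg(\mathcal B):\mathcal B\cong\mathcal A\}$. Products of subextensions of $\tilde K/K$ denote composita over $K$ (the empty compositum is $K$). \textbf{Theorem.} Let $K$ be a computable finitely generated field, and let $\tilde K$ be a computable algebraic closure of $K$, i.e. a computable field that is an algebraic closure of $K$ and for which the embedding $K\to\tilde K$ is computable. Let $(f_i)_{i\in\omega}$ be a computable sequence of monic polynomials in $K[T]$, irreducible over $K$. Let $\alpha_i\in\tilde K$ be a root of $f_i$, let $M_i=K(\alpha_i)$, let $M=\prod_{i\in\omega}M_i$, and for $X\subseteq\omega$ let $M_X=\prod_{i\in X}M_i$. Assume that (a) $(M_i)$ is totally linearly disjoint over $K$: for every $i$, $M_i$ is a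 finite extension of $K$ of degree $>1$, linearly disjoint over $K$ from $\prod_{j\ne i}M_j$; (b) $(M_i)$ is stable with respect to $K$: for every embedding $\sigma:M\hookrightarrow\tilde K$ that is the identity on $K$, and every $i$, either $\sigma(M_i)=M_i$ or $\sigma(M_i)\not\subset M$. Then there is an injection $\nu:M\hookrightarrow\omega$, whose restriction to $K$ is computable (with respect to the given presentation of $K$), such that, when every subfield of $M$ is identified with its copy with universe $\nu(\cdot)\subseteq\omega$, the fields $\mathcal A=K$, $\mathcal A_i=M_i$ and $\mathcal A_X=M_X$ satisfy the following conditions: \begin{itemize} \item $(\mathcal A_i)_{i\in\omega}$ is a computable sequence of computable fields, that is, the atomic diagram of $\mathcal A_i$ is computable uniformly in $i$. \item $\mathcal A$ is a finitely generated field, and $\mathcal A\subset\mathcal A_i$ for every $i\in\omega$. \item For every $X\subseteq\omega$: $\mathcal A\subset\mathcal A_X$; $\mathcal A_X\le_T X$; and for every $i\in\omega$, there is an embedding $\sigma:\mathcal A_i\hookrightarrow\mathcal A_X$ with $\sigma|_{\mathcal A}=\mathrm{id}$ if and only if $i\in X$. \item Let $X\subseteq\omega$, let $\mathcal B$ be a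 field with universe contained in $\omega$, and let $\tau:\mathcal A_X\to\mathcal B$ be an isomorphism. Let $\Lambda$ be the set of pairs $(i,j)$ such that exactly one of $\mathcal A_i$ and $\mathcal A_j$ embeds in $\mathcal B$ by an embedding $\sigma$ with $(\tau^{-1}\circ\sigma)|_{\mathcal A}=\mathrm{id}$. Then there is a procedure, computable relative to the atomic diagram of $\mathcal B$, which for every $(i,j)\in\Lambda$ halts and decides which of $\mathcal A_i$ and $\mathcal A_j$ so embeds in $\mathcal B$. \end{itemize} Consequently, for every Turing degree $\mathbf d$ there is a set $X\subseteq\omega$ such that the isomorphism type of the field $M_X$ has Turing degree $\mathbf d$; in particular there are fields whose isomorphism types have arbitrary Turing degrees. -/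

import Mathlib

open Polynomial IntermediateField

/-! ## Sets of natural numbers: characteristic functions and Turing reducibility -/

open Classical in
/-- The characteristic function of a set of natural numbers, as a (total) oracle. -/
noncomputable def charFun (S : Set ℕ) : ℕ →. ℕ :=
  fun n => Part.some (if n ∈ S then 1 else 0)

/-- `S` is Turing reducible to `T`, that is, `deg S ≤ deg T`. -/
def SetTuringLE (S T : Set ℕ) : Prop :=
  TuringReducible (charFun S) (charFun T)

/-- `S` and `T` have the same Turing degree. -/
def SetTuringEquiv (S T : Set ℕ) : Prop :=
  SetTuringLE S T ∧ SetTuringLE T S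

/-! ## Countable fields as structures whose universe is a set of natural numbers -/

/-- A field whose underlying set is a set of natural numbers. -/
structure CodedField where
  /-- the universe of the structure -/
  carrier : Set ℕ
  /-- the field operations on it -/
  inst : Field carrier

namespace CodedField

instance : CoeSort CodedField Type := ⟨fun F => F.carrier⟩

instance (F : CodedField) : Field F := F.inst

/-- The atomic diagram of a field whose elements are natural numbers, in the finite language
`{+, *, -, ⁻¹, 0, 1}` of fields (with the convention `0⁻¹ = 0`). The elements of the universe are
the new constants; the sentences are recorded in unnested form, that is, as the graphs of the
operations, coded by natural numbers. This set has the same Turing degree as the set of all true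
quantifier-free sentences with parameters (the universe is read off from the sentences
`a + b = c`, and equality of constants is equality of natural numbers). -/
def atomicDiagram (F : CodedField) : Set ℕ :=
  {n | (∃ a b : F, n = Nat.pair 0 (Nat.pair (a : ℕ) (Nat.pair (b : ℕ) ((a + b : F) : ℕ)))) ∨
    (∃ a b : F, n = Nat.pair 1 (Nat.pair (a : ℕ) (Nat.pair (b : ℕ) ((a * b : F) : ℕ)))) ∨
    (∃ a : F, n = Nat.pair 2 (Nat.pair (a : ℕ) ((-a : F) : ℕ))) ∨
    (∃ a : F, n = Nat.pair 3 (Nat.pair (a : ℕ) ((a⁻¹ : F) : ℕ))) ∨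
    n = Nat.pair 4 ((0 : F) : ℕ) ∨
    n = Nat.pair 5 ((1 : F) : ℕ)}

/-- `F` is a computable field: its atomic diagram is a computable set. -/
def IsComputable (F : CodedField) : Prop :=
  ComputablePred fun n : ℕ => n ∈ F.atomicDiagram

/-- `F 0, F 1, …` is a computable sequence of computable fields: their atomic diagrams are
computable uniformly in the index. -/
def IsComputableSeq (F : ℕ → CodedField) : Prop :=
  ComputablePred fun p : ℕ × ℕ => p.2 ∈ (F p.1).atomicDiagram

/-- A map between coded fields is computable if it is the restriction of a partial recursive
function of natural numbers. -/
def IsComputableMap {F G : CodedField} (φ : F → G) : Prop :=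
  ∃ g : ℕ →. ℕ, Partrec g ∧ ∀ x : F, ((φ x : G) : ℕ) ∈ g (x : ℕ)

/-- `A ⊂ B`: the field `A` is a substructure of the field `B`. -/
def IsSubstructure (A B : CodedField) : Prop :=
  ∃ φ : A →+* B, ∀ a : A, ((φ a : B) : ℕ) = (a : ℕ)

/-- The structure `Ai` embeds in `B` under some embedding `σ` such that `τ⁻¹ ∘ σ` is the identity
on `A`; here `A` is a substructure of `Ai` and of `AX`, and `τ : AX ≃ B` is an isomorphism. -/
def EmbedsOver (A Ai : CodedField) {AX B : CodedField} (τ : AX ≃+* B) : Prop :=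
  ∃ σ : Ai →+* B, ∀ x : Ai, (x : ℕ) ∈ A.carrier → ((τ.symm (σ x) : AX) : ℕ) = (x : ℕ)

/-- The copy of a countable field `F` along an injection of `F` into the natural numbers:
the universe is the range of the injection, and the operations are transported. -/
noncomputable def ofInjective {F : Type} [Field F] (ν : F → ℕ) (hν : Function.Injective ν) :
    CodedField where
  carrier := Set.range ν
  inst := (Equiv.ofInjective ν hν).symm.field

end CodedField

/-! ## The degree of an isomorphism type -/

/-- The isomorphism type of the countable field `F` has Turing degree `deg D`: `deg D` is the
least element of the set of degrees of the isomorphic copies of `F`. -/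
def IsoTypeHasDegree (F : Type) [Field F] (D : Set ℕ) : Prop :=
  (∃ B : CodedField, Nonempty (F ≃+* B) ∧ SetTuringEquiv B.atomicDiagram D) ∧
    ∀ B : CodedField, Nonempty (F ≃+* B) → SetTuringLE D B.atomicDiagram

/-! ## The conditions on a sequence of structures, for the class of countable fields -/

/-- The conditions on a sequence `Ai` of structures, a structure `A` and structures `AX X`
(`X ⊆ ω`), for the class of all countable fields in the language of fields. -/
structure DegreeConditions (A : CodedField) (Ai : ℕ → CodedField) (AX : Set ℕ → CodedField) :
    Prop where
  /-- the `Ai` form a computable sequence of computable structures -/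
  computable_seq : CodedField.IsComputableSeq Ai
  /-- `A` is finitely generated (as a structure in the language of fields) -/
  fg : Field.FG A
  /-- `A` is a substructure of every `Ai` -/
  sub_Ai : ∀ i, A.IsSubstructure (Ai i)
  /-- `A` is a substructure of every `AX X` -/
  sub_AX : ∀ X, A.IsSubstructure (AX X)
  /-- `AX X ≤_T X` -/
  AX_le : ∀ X, SetTuringLE (AX X).atomicDiagram X
  /-- `Ai` embeds in `AX X` over `A` exactly when `i ∈ X` -/
  embeds_iff : ∀ X i, CodedField.EmbedsOver A (Ai i) (RingEquiv.refl (AX X)) ↔ i ∈ X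
  /-- For every isomorphic copy `τ : AX X ≃ B` there is a procedure computable in `B` which, given
  `(i, j)` such that exactly one of `Ai i`, `Ai j` embeds in `B` over `A`, halts and tells which
  one: the answer is `true` for the first and `false` for the second. -/
  decides : ∀ (X : Set ℕ) (B : CodedField) (τ : AX X ≃+* B),
    ∃ P : ℕ × ℕ →. Bool, RecursiveIn {charFun B.atomicDiagram} P ∧
      ∀ i j : ℕ,
        (CodedField.EmbedsOver A (Ai i) τ ∧ ¬ CodedField.EmbedsOver A (Ai j) τ →
          true ∈ P (i, j)) ∧
        (CodedField.EmbedsOver A (Ai j) τ ∧ ¬ CodedField.EmbedsOver A (Ai i) τ →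
          false ∈ P (i, j))

/-! ## Sequences of extensions -/

section Extensions

variable {F E : Type} [Field F] [Field E] [Algebra F E]

/-- A sequence of finite extensions of `F` inside `E` is totally linearly disjoint over `F` if each
of them has degree `> 1` and is linearly disjoint over `F` from the compositum of all the others. -/
def TotallyLinearlyDisjoint (L : ℕ → IntermediateField F E) : Prop :=
  ∀ i, FiniteDimensional F (L i) ∧ 1 < Module.finrank F (L i) ∧
    (L i).LinearDisjoint (⨆ j ∈ ({i}ᶜ : Set ℕ), L j : IntermediateField F E)

/-- A sequence of algebraic extensions `L i` of `F` inside an algebraic closure `E` of `F`, with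
compositum `L`, is stable with respect to `F` if every embedding `σ : L → E` over `F` satisfies,
for every `i`, `σ (L i) = L i` or `σ (L i) ⊄ L`. -/
def IsStable (L : ℕ → IntermediateField F E) : Prop :=
  ∀ σ : (⨆ i, L i : IntermediateField F E) →ₐ[F] E, ∀ i,
    (σ.comp (inclusion (le_iSup L i))).fieldRange = L i ∨
      ¬ (σ.comp (inclusion (le_iSup L i))).fieldRange ≤ ⨆ i, L i

/-- The compositum over `F` of the `L i` with `i ∈ X`; it is `F` itself when `X` is empty. -/
def compositum (L : ℕ → IntermediateField F E) (X : Set ℕ) : IntermediateField F E :=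
  ⨆ i ∈ X, L i

theorem compositum_le (L : ℕ → IntermediateField F E) (X : Set ℕ) :
    compositum L X ≤ ⨆ i, L i :=
  iSup₂_le fun i _ => le_iSup L i

/-- The coded copy of a subextension `S` of `L`, given an injection `ν` of `L` into the natural
numbers: the universe is `ν(S)`. Copies of `S ≤ T ≤ L` made with the same `ν` are literally
substructures of each other. -/
noncomputable def codedCopy {L : IntermediateField F E} (ν : L ↪ ℕ)
    (S : IntermediateField F E) (h : S ≤ L) : CodedField :=
  CodedField.ofInjective (fun x : S => ν (inclusion h x))
    (ν.injective.comp (inclusion h).injective)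

/-- The coded copy of the base field `F`, given an injection `ν` of `L` into the natural numbers:
the universe is the image of `F ⊆ L` under `ν`. -/
noncomputable def codedBase {L : IntermediateField F E} (ν : L ↪ ℕ) : CodedField :=
  CodedField.ofInjective (fun x : F => ν (algebraMap F L x))
    (ν.injective.comp (algebraMap F L).injective)

end Extensions

/-- `Kt`, with its structure map from `K`, is a computable algebraic closure of `K`. -/
def IsComputableAlgClosure (K Kt : CodedField) [Algebra K Kt] : Prop :=
  IsAlgClosure K Kt ∧ Kt.IsComputable ∧ CodedField.IsComputableMap (algebraMap K Kt)

/-- A computable sequence of polynomials over a coded field: the (finite) list of the coefficients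
of `f i`, starting with the constant coefficient and ending with the leading one, is computable
from `i`. -/
def IsComputablePolySeq {K : CodedField} (f : ℕ → K[X]) : Prop :=
  Computable fun i : ℕ =>
    (List.range ((f i).natDegree + 1)).map fun n => (((f i).coeff n : K) : ℕ)

/-!
The fields `M_X` are presented so that membership of a name in `M_X` is a positive condition on `X`,
and `X` is recovered from any copy of `M_X` by looking for roots of the polynomials `f i`.

*The presentation.* Total linear disjointness makes the monomials in the `α i` whose exponents stay
below the degrees of the `f i` a basis of `M` over `K` (`linearIndepOn_reducedExponents`,
`supported_le_reduced_sup`). Every element of `M` is therefore the value of exactly one reduced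
polynomial in the `α i`, and it lies in `M_X` exactly when the variables of that polynomial belong
to `X` (`reduced_aeval_mem_iff`). The given roots `α i` need not be computable from `i`, but roots
`r i` of the `f i` can be found by search in the algebraic closure, and by the same reduction `α i ↦
r i` defines an embedding `ψ` of `M` over `K` (`aeval_eq_zero_of_aeval_eq_zero`). Reduced
polynomials are named by numbers, the values of `ψ` at the named elements are computable
(`exists_isNaming`), and `ν` sends an element to its least name (`IsNaming.leastName`). The atomic
diagram of `M_X` then consists of the numbers satisfying a computable condition and finitely many
conditions `i ∈ X` (`IsNaming.mem_atomicDiagram_iff`). This gives `M_X ≤_T X` and, for `X = {i}`,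
the uniform computability of the `M_i`.

*Embeddings.* Extensions to `M_i = K(α i)` of an embedding of `K` in a field correspond to the roots
of `f i` in that field (`exists_ringHom_adjoin_simple_iff`). If `f i` has a root in `M_X`, the
corresponding conjugate of `M_i` lies in `M`, so by stability it equals `M_i` and `M_i ⊆ M_X`;
linear disjointness and `[M_i : K] > 1` then force `i ∈ X` (`exists_root_mem_compositum_iff`).

*Decision.* Let `B` be a copy of `M_X`. As `K` is finitely generated, the embedding of `K` in `B`
has a graph recursively enumerable in `B`: a value is certified by a derivation from the generators,
carried out in `K` and `B` in parallel (`reIn_graph`). Hence the set of the `i` such that `f i` has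
a root in `B`, which is `X`, is recursively enumerable in `B` (`reIn_exists_root`); enumerating it
decides between `i` and `j` when exactly one of them belongs to `X`. Taking `X = D ⊕ Dᶜ`, which is
computable from `D`, every copy of `M_X` computes `D`, and the copy constructed above is computed by
`D`.
-/

/-! ### Computable predicates -/

namespace ComputablePred

variable {α β : Type*} [Primcodable α] [Primcodable β]

theorem comp {p : β → Prop} {f : α → β} (hp : ComputablePred p) (hf : Computable f) :
    ComputablePred fun a => p (f a) := by
  classical
  exact (hp.decide.comp hf).computablePred

theorem and {p q : α → Prop} (hp : ComputablePred p) (hq : ComputablePred q) :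
    ComputablePred fun a => p a ∧ q a := by
  classical
  refine Computable.computablePred ((Primrec.and.to_comp.comp hp.decide hq.decide).of_eq ?_)
  simp

theorem or {p q : α → Prop} (hp : ComputablePred p) (hq : ComputablePred q) :
    ComputablePred fun a => p a ∨ q a :=
  (hp.not.and hq.not).not.of_eq fun a => by tauto

theorem imp {p q : α → Prop} (hp : ComputablePred p) (hq : ComputablePred q) :
    ComputablePred fun a => p a → q a :=
  (hp.not.or hq).of_eq fun a => by tauto

theorem eq [DecidableEq β] {f g : α → β} (hf : Computable f) (hg : Computable g) :
    ComputablePred fun a => f a = g a := by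
  have : ComputablePred fun p : β × β => p.1 = p.2 :=
    (Primrec.eq (α := β)).decide.to_comp.computablePred
  exact this.comp (hf.pair hg)

theorem lt {f g : α → ℕ} (hf : Computable f) (hg : Computable g) :
    ComputablePred fun a => f a < g a := by
  have : ComputablePred fun p : ℕ × ℕ => p.1 < p.2 :=
    Primrec.nat_lt.decide.to_comp.computablePred
  exact this.comp (hf.pair hg)

theorem forall_lt {p : α → ℕ → Prop} {f : α → ℕ}
    (hp : ComputablePred fun q : α × ℕ => p q.1 q.2) (hf : Computable f) :
    ComputablePred fun a => ∀ k < f a, p a k := by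
  classical
  have h : Computable fun a =>
      Nat.rec (motive := fun _ => Bool) true (fun k b => (decide (p a k) && b)) (f a) :=
    Computable.nat_rec (h := fun a (y : ℕ × Bool) => (decide (p a y.1) && y.2)) hf
      (Computable.const true)
      (Primrec.and.to_comp.comp
        (hp.decide.comp (Computable.fst.pair (Computable.fst.comp Computable.snd)))
        (Computable.snd.comp Computable.snd)).to₂
  refine Computable.computablePred (h.of_eq fun a => ?_)
  induction f a with
  | zero => simp
  | succ n ih =>
    simp only [ih, ← Bool.decide_and, decide_eq_decide]
    exact ⟨fun h k hk => (Nat.lt_succ_iff_lt_or_eq.1 hk).elim (h.2 k) (fun e => e ▸ h.1),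
      fun h => ⟨h n (by simp), fun k hk => h k (by omega)⟩⟩

theorem exists_lt {p : α → ℕ → Prop} {f : α → ℕ}
    (hp : ComputablePred fun q : α × ℕ => p q.1 q.2) (hf : Computable f) :
    ComputablePred fun a => ∃ k < f a, p a k :=
  (forall_lt (p := fun a k => ¬ p a k) hp.not hf).not.of_eq fun a => by simp

end ComputablePred

theorem Computable.ite {α β : Type*} [Primcodable α] [Primcodable β] {p : α → Prop}
    [DecidablePred p] {f g : α → β} (hp : ComputablePred p) (hf : Computable f)
    (hg : Computable g) : Computable fun a => if p a then f a else g a := by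
  simpa [Bool.cond_decide] using hp.decide.cond hf hg

theorem Computable.natPair {α : Type*} [Primcodable α] {f g : α → ℕ} (hf : Computable f)
    (hg : Computable g) : Computable fun a => Nat.pair (f a) (g a) :=
  Primrec₂.natPair.to_comp.comp hf hg

/-! ### Searching with an oracle -/

/-- The list of the first `s` values of the characteristic function of `S`. -/
noncomputable def charPrefix (S : Set ℕ) (s : ℕ) : List ℕ :=
  open Classical in (List.range s).map fun n => if n ∈ S then 1 else 0

theorem charPrefix_length (S : Set ℕ) (s : ℕ) : (charPrefix S s).length = s := by
  simp [charPrefix]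

theorem charPrefix_getD (S : Set ℕ) {s n : ℕ} :
    (charPrefix S s).getD n 0 = 1 ↔ n < s ∧ n ∈ S := by
  classical
  by_cases h : n < s <;> by_cases h' : n ∈ S <;> simp [charPrefix, h, h']

theorem Computable.natRecursiveIn {g : ℕ → ℕ} (hg : Computable g) (O : Set (ℕ →. ℕ)) :
    Nat.RecursiveIn O fun n => Part.some (g n) :=
  RecursiveIn.iff_nat.1 hg.computableIn

theorem Nat.RecursiveIn.pair_some {O : Set (ℕ →. ℕ)} {f g : ℕ → ℕ}
    (hf : Nat.RecursiveIn O fun n => Part.some (f n))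
    (hg : Nat.RecursiveIn O fun n => Part.some (g n)) :
    Nat.RecursiveIn O fun n => Part.some (Nat.pair (f n) (g n)) :=
  (hf.pair hg).of_eq fun n => by simp [Seq.seq]

theorem Nat.RecursiveIn.comp_some {O : Set (ℕ →. ℕ)} {f : ℕ →. ℕ} {g : ℕ → ℕ}
    (hf : Nat.RecursiveIn O f) (hg : Nat.RecursiveIn O fun n => Part.some (g n)) :
    Nat.RecursiveIn O fun n => f (g n) :=
  (hf.comp hg).of_eq fun n => Part.bind_some (g n) f

theorem natRecursiveIn_charPrefix (S : Set ℕ) :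
    Nat.RecursiveIn {charFun S} fun s => Part.some (Encodable.encode (charPrefix S s)) := by
  classical
  let G : ℕ → ℕ := fun q =>
    Encodable.encode ((Denumerable.ofNat (List ℕ) q.unpair.1) ++ [q.unpair.2])
  have hG : Computable G := by
    refine Computable.encode.comp (Computable.list_concat.comp ?_ ?_)
    · exact (Primrec.ofNat _).to_comp.comp (Computable.fst.comp Computable.unpair)
    · exact Computable.snd.comp Computable.unpair
  have hy : Computable fun q : ℕ => q.unpair.2.unpair.1 :=
    Computable.fst.comp (Computable.unpair.comp (Computable.snd.comp Computable.unpair))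
  have hi : Computable fun q : ℕ => q.unpair.2.unpair.2 :=
    Computable.snd.comp (Computable.unpair.comp (Computable.snd.comp Computable.unpair))
  have hchi : Nat.RecursiveIn {charFun S} fun q =>
      Part.some (if q.unpair.2.unpair.1 ∈ S then 1 else 0) :=
    (Nat.RecursiveIn.oracle (charFun S) (Set.mem_singleton _)).comp_some (hy.natRecursiveIn _)
  -- The step receives `y` and the code of the list of the values below `y`, and appends the value
  -- at `y`.
  have hstep := (hG.natRecursiveIn {charFun S}).comp_some
    ((hi.natRecursiveIn {charFun S}).pair_some hchi)
  have hbase := (Computable.const (Encodable.encode ([] : List ℕ)) (α := ℕ)).natRecursiveIn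
    {charFun S}
  have hpair : Computable fun n : ℕ => Nat.pair 0 n :=
    Computable.natPair (Computable.const 0) Computable.id
  refine ((hbase.prec hstep).comp_some (hpair.natRecursiveIn _)).of_eq fun s => ?_
  simp only [Nat.unpair_pair]
  induction s with
  | zero => simp [charPrefix]
  | succ s ih =>
    simp only [ih]
    simp [G, charPrefix, List.range_succ]

/-- Unbounded search relative to `S`: a computable test is applied to longer and longer initial
segments of the characteristic function of `S` until it gives a value. -/
theorem natRecursiveIn_rfindOpt_charPrefix (S : Set ℕ) {g : ℕ → List ℕ → Option ℕ}
    (hg : Computable₂ g) :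
    Nat.RecursiveIn {charFun S} fun n => Nat.rfindOpt fun s => g n (charPrefix S s) := by
  have hdec : Computable fun q : ℕ => g q.unpair.1 (Denumerable.ofNat (List ℕ) q.unpair.2) :=
    hg.comp (Computable.fst.comp Computable.unpair)
      ((Primrec.ofNat _).to_comp.comp (Computable.snd.comp Computable.unpair))
  have hq : Nat.RecursiveIn {charFun S} fun q : ℕ =>
      Part.some (Nat.pair q.unpair.1 (Encodable.encode (charPrefix S q.unpair.2))) :=
    ((Computable.fst.comp Computable.unpair).natRecursiveIn _).pair_some
      ((natRecursiveIn_charPrefix S).comp_some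
        ((Computable.snd.comp Computable.unpair).natRecursiveIn _))
  have htest : Nat.RecursiveIn {charFun S} fun q : ℕ =>
      Part.some (cond (g q.unpair.1 (charPrefix S q.unpair.2)).isSome 0 1) := by
    have h : Computable fun q : ℕ =>
        cond (g q.unpair.1 (Denumerable.ofNat (List ℕ) q.unpair.2)).isSome 0 1 :=
      (Primrec.option_isSome.to_comp.comp hdec).cond (Computable.const 0) (Computable.const 1)
    exact ((h.natRecursiveIn _).comp_some hq).of_eq fun q => by simp
  have hout : Nat.RecursiveIn {charFun S} fun q : ℕ =>
      (g q.unpair.1 (charPrefix S q.unpair.2) : Part ℕ) := by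
    have h : Nat.RecursiveIn {charFun S} fun q : ℕ =>
        (g q.unpair.1 (Denumerable.ofNat (List ℕ) q.unpair.2) : Part ℕ) :=
      RecursiveIn.iff_nat.1 hdec.ofOption.recursiveIn
    exact (h.comp_some hq).of_eq fun q => by simp
  have hid := Computable.id.natRecursiveIn {charFun S}
  have := hout.comp (hid.pair htest.rfind)
  refine this.of_eq fun n => ?_
  have hb (o : Option ℕ) : decide (cond o.isSome 0 1 = 0) = o.isSome := by cases o <;> simp
  simp [Nat.rfindOpt, Seq.seq, hb]

theorem recursiveIn_rfindOpt_charPrefix {α β : Type*} [Primcodable α] [Primcodable β] (S : Set ℕ)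
    {g : α → List ℕ → Option β} (hg : Computable₂ g) :
    RecursiveIn {charFun S} fun a => Nat.rfindOpt fun s => g a (charPrefix S s) := by
  let g' : ℕ → List ℕ → Option ℕ := fun n l =>
    (Encodable.decode (α := α) n).bind fun a => (g a l).map Encodable.encode
  have hg' : Computable₂ g' :=
    Computable.option_bind (Computable.decode.comp Computable.fst)
      (Computable.option_map (hg.comp Computable.snd (Computable.snd.comp Computable.fst))
        (Computable.encode.comp Computable.snd).to₂).to₂
  refine (natRecursiveIn_rfindOpt_charPrefix S hg').of_eq fun n => ?_
  cases h : Encodable.decode (α := α) n with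
  | none =>
    refine (Part.eq_none_iff'.2 fun hd => ?_).trans (by simp)
    obtain ⟨s, b, hb⟩ := Nat.rfindOpt_dom.1 hd
    simp [g', h] at hb
  | some a =>
    ext b
    simp [g', h, Nat.rfindOpt]

/-- A set defined by computable conditions and by positive conditions on elements of `X` is Turing
reducible to `X`. -/
theorem setTuringLE_of_forall_lt {X : Set ℕ} {P : ℕ → Prop} {Q : ℕ → ℕ → Prop}
    (hP : ComputablePred P) (hQ : ComputablePred fun q : ℕ × ℕ => Q q.1 q.2) :
    SetTuringLE {n | P n ∧ ∀ i < n, Q n i → i ∈ X} X := by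
  classical
  let R : ℕ × List ℕ → Prop := fun p => P p.1 ∧ ∀ i < p.1, Q p.1 i → p.2.getD i 0 = 1
  have hR : ComputablePred R :=
    (hP.comp Computable.fst).and <| ComputablePred.forall_lt
      ((hQ.comp ((Computable.fst.comp Computable.fst).pair Computable.snd)).imp
        (ComputablePred.eq ((Primrec.list_getD 0).to_comp.comp
          (Computable.snd.comp Computable.fst) Computable.snd) (Computable.const 1)))
      Computable.fst
  have hg : Computable₂ fun (n : ℕ) (l : List ℕ) =>
      if n < l.length then some (if R (n, l) then 1 else 0) else none :=
    Computable.ite (ComputablePred.lt Computable.fst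
        (Computable.list_length.comp Computable.snd))
      (Computable.option_some.comp (Computable.ite hR (Computable.const 1) (Computable.const 0)))
      (Computable.const none)
  refine (recursiveIn_rfindOpt_charPrefix X hg).of_eq fun n => ?_
  have hval : ∀ s, n < s → (R (n, charPrefix X s) ↔ n ∈ {n | P n ∧ ∀ i < n, Q n i → i ∈ X}) := by
    intro s hs
    simp only [R, charPrefix_getD, Set.mem_ofPred_eq]
    refine and_congr_right fun _ => forall_congr' fun i => forall_congr' fun hi => ?_
    simp [hi.trans hs]
  rw [charFun, Part.eq_some_iff]
  have hd : (Nat.rfindOpt fun s => if n < (charPrefix X s).length then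
      some (if R (n, charPrefix X s) then 1 else 0) else none).Dom :=
    Nat.rfindOpt_dom.2 ⟨n + 1, _, by simp [charPrefix_length]; rfl⟩
  obtain ⟨b, hb⟩ := Part.dom_iff_mem.1 hd
  obtain ⟨s, hs⟩ := Nat.rfindOpt_spec hb
  rw [charPrefix_length] at hs
  by_cases hns : n < s
  · simp only [hns, if_true, Option.mem_def, Option.some.injEq, hval s hns] at hs
    rw [← hs] at hb
    convert hb
  · simp [hns] at hs

/-! ### Predicates recursively enumerable in a set -/

section REIn

variable {α β : Type*} [Primcodable α] [Primcodable β] {S : Set ℕ}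

/-- `p` is recursively enumerable in `S`: membership is witnessed by a finite initial segment of
the characteristic function of `S`. -/
def REIn (S : Set ℕ) (p : α → Prop) : Prop :=
  ∃ R : α × List ℕ → Prop, ComputablePred R ∧ ∀ a, p a ↔ ∃ s, R (a, charPrefix S s)

namespace REIn

theorem charPrefix_take {s t : ℕ} (h : s ≤ t) :
    (charPrefix S t).take s = charPrefix S s := by
  simp [charPrefix, ← List.map_take, List.take_range, h]

/-- The witnessing relation can be taken to be preserved by longer initial segments. -/
theorem exists_monotone {p : α → Prop} (hp : REIn S p) :
    ∃ R : α × List ℕ → Prop, ComputablePred R ∧ (∀ a, p a ↔ ∃ s, R (a, charPrefix S s)) ∧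
      ∀ a s t, s ≤ t → R (a, charPrefix S s) → R (a, charPrefix S t) := by
  obtain ⟨R, hR, h⟩ := hp
  have key : ∀ a t, (∃ s < (charPrefix S t).length + 1, R (a, (charPrefix S t).take s)) ↔
      ∃ s ≤ t, R (a, charPrefix S s) := by
    intro a t
    simp only [charPrefix_length, Nat.lt_succ_iff]
    refine exists_congr fun s => and_congr_right fun hs => ?_
    rw [charPrefix_take hs]
  refine ⟨fun q => ∃ s < q.2.length + 1, R (q.1, q.2.take s), ?_, fun a => ?_, fun a s t hst => ?_⟩
  · refine ComputablePred.exists_lt (hR.comp ?_)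
      (Computable.succ.comp (Computable.list_length.comp Computable.snd))
    exact (Computable.fst.comp Computable.fst).pair
      (Primrec.list_take.to_comp.comp Computable.snd (Computable.snd.comp Computable.fst))
  · rw [h]
    simp only [key]
    exact ⟨fun ⟨s, hs⟩ => ⟨s, s, le_rfl, hs⟩, fun ⟨_, s, _, hs⟩ => ⟨s, hs⟩⟩
  · simp only [key]
    exact fun ⟨s', h1, h2⟩ => ⟨s', h1.trans hst, h2⟩

theorem of_computablePred {p : α → Prop} (hp : ComputablePred p) : REIn S p :=
  ⟨fun q => p q.1, hp.comp Computable.fst, fun _ => by simp⟩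

theorem comp {p : β → Prop} (hp : REIn S p) {f : α → β} (hf : Computable f) :
    REIn S fun a => p (f a) := by
  obtain ⟨R, hR, h⟩ := hp
  exact ⟨fun q => R (f q.1, q.2),
    hR.comp ((hf.comp Computable.fst).pair Computable.snd), fun a => h (f a)⟩

theorem of_iff {p q : α → Prop} (hp : REIn S p) (h : ∀ a, q a ↔ p a) : REIn S q := by
  rwa [funext fun a => propext (h a)]

theorem mem {f : α → ℕ} (hf : Computable f) : REIn S fun a => f a ∈ S := by
  refine ⟨fun q => q.2.getD (f q.1) 0 = 1, ?_, fun a => ?_⟩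
  · exact ComputablePred.eq ((Primrec.list_getD 0).to_comp.comp Computable.snd
      (hf.comp Computable.fst)) (Computable.const 1)
  · simp only [charPrefix_getD]
    exact ⟨fun h => ⟨f a + 1, by simp, h⟩, fun ⟨_, _, h⟩ => h⟩

theorem and {p q : α → Prop} (hp : REIn S p) (hq : REIn S q) : REIn S fun a => p a ∧ q a := by
  obtain ⟨R, hR, h, hm⟩ := hp.exists_monotone
  obtain ⟨R', hR', h', hm'⟩ := hq.exists_monotone
  refine ⟨fun a => R a ∧ R' a, hR.and hR', fun a => ?_⟩
  simp only [h, h']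
  exact ⟨fun ⟨⟨s, hs⟩, t, ht⟩ => ⟨max s t, hm _ _ _ (le_max_left _ _) hs,
    hm' _ _ _ (le_max_right _ _) ht⟩, fun ⟨s, h1, h2⟩ => ⟨⟨s, h1⟩, s, h2⟩⟩

theorem or {p q : α → Prop} (hp : REIn S p) (hq : REIn S q) : REIn S fun a => p a ∨ q a := by
  obtain ⟨R, hR, h⟩ := hp
  obtain ⟨R', hR', h'⟩ := hq
  refine ⟨fun a => R a ∨ R' a, hR.or hR', fun a => ?_⟩
  simp only [h, h', exists_or]

theorem ex {p : α → ℕ → Prop} (hp : REIn S fun q : α × ℕ => p q.1 q.2) :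
    REIn S fun a => ∃ n, p a n := by
  obtain ⟨R, hR, h, hm⟩ := hp.exists_monotone
  refine ⟨fun q => ∃ n < q.2.length, R ((q.1, n), q.2), ?_, fun a => ?_⟩
  · exact ComputablePred.exists_lt (hR.comp (((Computable.fst.comp Computable.fst).pair
      Computable.snd).pair (Computable.snd.comp Computable.fst)))
      (Computable.list_length.comp Computable.snd)
  · simp only [charPrefix_length]
    constructor
    · rintro ⟨n, hn⟩
      obtain ⟨s, hs⟩ := (h (a, n)).1 hn
      exact ⟨max s (n + 1), n, by simp, hm _ _ _ (le_max_left _ _) hs⟩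
    · rintro ⟨s, n, -, hs⟩
      exact ⟨n, (h (a, n)).2 ⟨s, hs⟩⟩

theorem forall_lt {p : α → ℕ → Prop} (hp : REIn S fun q : α × ℕ => p q.1 q.2) {f : α → ℕ}
    (hf : Computable f) : REIn S fun a => ∀ k < f a, p a k := by
  obtain ⟨R, hR, h, hm⟩ := hp.exists_monotone
  refine ⟨fun q => ∀ k < f q.1, R ((q.1, k), q.2), ?_, fun a => ?_⟩
  · exact ComputablePred.forall_lt (hR.comp (((Computable.fst.comp Computable.fst).pair
      Computable.snd).pair (Computable.snd.comp Computable.fst))) (hf.comp Computable.fst)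
  · constructor
    · intro hk
      choose! s hs using fun k (hk' : k < f a) => (h (a, k)).1 (hk k hk')
      exact ⟨(Finset.range (f a)).sup s, fun k hk' =>
        hm _ _ _ (Finset.le_sup (f := s) (Finset.mem_range.2 hk')) (hs k hk')⟩
    · rintro ⟨s, hs⟩ k hk
      exact (h (a, k)).2 ⟨s, hs k hk⟩

/-- If exactly one of two elements has a property recursively enumerable in `S`, then running the
two enumerations in parallel tells which. -/
theorem exists_recursiveIn_decides {p : α → Prop} (hp : REIn S p) :
    ∃ P : α × α →. Bool, RecursiveIn {charFun S} P ∧ ∀ a b,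
      (p a ∧ ¬ p b → true ∈ P (a, b)) ∧ (p b ∧ ¬ p a → false ∈ P (a, b)) := by
  classical
  obtain ⟨R, hR, h⟩ := hp
  have hg : Computable₂ fun (q : α × α) (l : List ℕ) =>
      if R (q.1, l) then some true else if R (q.2, l) then some false else none :=
    Computable.ite (hR.comp ((Computable.fst.comp Computable.fst).pair Computable.snd))
      (Computable.const _) (Computable.ite
        (hR.comp ((Computable.snd.comp Computable.fst).pair Computable.snd))
        (Computable.const _) (Computable.const _))
  refine ⟨_, recursiveIn_rfindOpt_charPrefix S hg, fun a b => ⟨?_, ?_⟩⟩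
  · rintro ⟨ha, hb⟩
    have hb' : ∀ s, ¬ R (b, charPrefix S s) := fun s hs => hb ((h b).2 ⟨s, hs⟩)
    obtain ⟨s, hs⟩ := (h a).1 ha
    obtain ⟨c, hc⟩ := Part.dom_iff_mem.1 ((Nat.rfindOpt_dom (f := fun s =>
      if R (a, charPrefix S s) then some true else
        if R (b, charPrefix S s) then some false else none)).2 ⟨s, true, by simp [hs]⟩)
    obtain ⟨t, ht⟩ := Nat.rfindOpt_spec hc
    simp only [hb', if_false] at ht
    obtain rfl : c = true := by
      split_ifs at ht
      · simpa using ht.symm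
      · simp at ht
    exact hc
  · rintro ⟨hb, ha⟩
    have ha' : ∀ s, ¬ R (a, charPrefix S s) := fun s hs => ha ((h a).2 ⟨s, hs⟩)
    obtain ⟨s, hs⟩ := (h b).1 hb
    obtain ⟨c, hc⟩ := Part.dom_iff_mem.1 ((Nat.rfindOpt_dom (f := fun s =>
      if R (a, charPrefix S s) then some true else
        if R (b, charPrefix S s) then some false else none)).2 ⟨s, false, by simp [hs, ha']⟩)
    obtain ⟨t, ht⟩ := Nat.rfindOpt_spec hc
    simp only [ha', if_false] at ht
    obtain rfl : c = false := by
      split_ifs at ht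
      · simpa using ht.symm
      · simp at ht
    exact hc

end REIn

end REIn

/-! ### Finite sequences coded by numbers -/

/-- The `i`-th entry of the finite sequence coded by `k`, continued by zeros. -/
def seqEntry (k i : ℕ) : ℕ := (Denumerable.ofNat (List ℕ) k).getD i 0

theorem computable_seqEntry : Computable₂ seqEntry :=
  ((Primrec.list_getD 0).comp ((Primrec.ofNat _).comp Primrec.fst) Primrec.snd).to_comp

theorem seqEntry_eq_zero {k i : ℕ} (h : k ≤ i) : seqEntry k i = 0 := by
  have := Encodable.length_le_encode (Denumerable.ofNat (List ℕ) k)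
  rw [Denumerable.encode_ofNat] at this
  exact List.getD_eq_default _ _ (this.trans h)

theorem exists_seqEntry_eq (d : ℕ → ℕ) (n : ℕ) :
    ∃ k, ∀ i, seqEntry k i = if i < n then d i else 0 := by
  refine ⟨Encodable.encode ((List.range n).map d), fun i => ?_⟩
  by_cases h : i < n <;> simp [seqEntry, h]

/-! ### Reduced polynomials in the generators -/

section ReducedPolynomials

variable {K E : Type} [Field K] [Field E] [Algebra K E]

/-- The exponents of the monomials in the variables from `X` in which the exponent of the `i`-th
variable is less than `n i`. -/
def reducedExponents (n : ℕ → ℕ) (X : Set ℕ) : Set (ℕ →₀ ℕ) :=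
  {d | (∀ i, d i < n i) ∧ ∀ i, d i ≠ 0 → i ∈ X}

theorem reducedExponents_mono (n : ℕ → ℕ) {X Y : Set ℕ} (h : X ⊆ Y) :
    reducedExponents n X ⊆ reducedExponents n Y :=
  fun _ hd => ⟨hd.1, fun i hi => h (hd.2 i hi)⟩

variable {α : ℕ → E} {n : ℕ → ℕ}

/-- The variables are added one at a time: each generator is linearly disjoint from the compositum
of the others, so products of its powers with reduced monomials in the others stay independent. -/
theorem linearIndepOn_reducedExponents_finset
    (hpow : ∀ i, LinearIndependent K fun d : Fin (n i) => α i ^ (d : ℕ))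
    (hdisj : ∀ i, K⟮α i⟯.LinearDisjoint
      (⨆ j ∈ ({i}ᶜ : Set ℕ), K⟮α j⟯ : IntermediateField K E)) (s : Finset ℕ) :
    LinearIndepOn K (fun d : ℕ →₀ ℕ => d.prod fun i m => α i ^ m)
      (reducedExponents n (s : Set ℕ)) := by
  classical
  induction s using Finset.induction_on with
  | empty =>
    have hsub : reducedExponents n ((∅ : Finset ℕ) : Set ℕ) ⊆ {0} := by
      intro d hd
      ext i
      by_contra h
      simpa using hd.2 i h
    refine LinearIndepOn.mono ?_ hsub
    rw [linearIndepOn_singleton_iff]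
    simp
  | insert i s his ih =>
    set B : IntermediateField K E := ⨆ j ∈ ({i}ᶜ : Set ℕ), K⟮α j⟯ with hB
    have hmem : ∀ j ∈ s, α j ∈ B := fun j hj =>
      le_iSup₂_of_le (f := fun j (_ : j ∈ ({i}ᶜ : Set ℕ)) => K⟮α j⟯) j
        (by rintro rfl; exact his hj) le_rfl (mem_adjoin_simple_self K _)
    let a : Fin (n i) → K⟮α i⟯ := fun d => AdjoinSimple.gen K (α i) ^ (d : ℕ)
    let b : reducedExponents n (s : Set ℕ) → B := fun d =>
      ⟨d.1.prod fun i m => α i ^ m, prod_mem fun j hj =>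
        pow_mem (hmem j (d.2.2 j (Finsupp.mem_support_iff.1 hj))) _⟩
    have ha : LinearIndependent K a :=
      LinearIndependent.of_comp (K⟮α i⟯.val.toLinearMap) (hpow i)
    have hb : LinearIndependent K b :=
      LinearIndependent.of_comp (B.val.toLinearMap) ih
    let φ : reducedExponents n ((insert i s : Finset ℕ) : Set ℕ) →
        Fin (n i) × reducedExponents n (s : Set ℕ) := fun d =>
      (⟨d.1 i, d.2.1 i⟩, ⟨d.1.erase i, fun j => by
          by_cases hj : j = i
          · subst hj
            simpa using Nat.zero_lt_of_lt (d.2.1 j)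
          · simpa [Finsupp.erase_ne hj] using d.2.1 j, fun j hj => by
          have hji : j ≠ i := by rintro rfl; simp at hj
          rw [Finsupp.erase_ne hji] at hj
          simpa [hji] using d.2.2 j hj⟩)
    have hφ : Function.Injective φ := by
      intro d d' h
      have h1 : d.1 i = d'.1 i := congrArg (fun q => (q.1 : ℕ)) h
      have h2 : d.1.erase i = d'.1.erase i := congrArg (fun q => q.2.1) h
      ext j
      by_cases hj : j = i
      · rw [hj]; exact h1
      · simpa [Finsupp.erase_ne hj] using DFunLike.congr_fun h2 j
    have := ((hdisj i).linearIndependent_mul ha hb).comp φ hφ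
    rw [LinearIndepOn]
    convert this using 1
    ext d
    exact (Finsupp.mul_prod_erase' d.1 i _ fun j => pow_zero _).symm

theorem linearIndepOn_reducedExponents
    (hpow : ∀ i, LinearIndependent K fun d : Fin (n i) => α i ^ (d : ℕ))
    (hdisj : ∀ i, K⟮α i⟯.LinearDisjoint
      (⨆ j ∈ ({i}ᶜ : Set ℕ), K⟮α j⟯ : IntermediateField K E)) :
    LinearIndepOn K (fun d : ℕ →₀ ℕ => d.prod fun i m => α i ^ m)
      (reducedExponents n Set.univ) := by
  have h : reducedExponents n Set.univ = ⋃ s : Finset ℕ, reducedExponents n (s : Set ℕ) := by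
    ext d
    simp only [Set.mem_iUnion]
    exact ⟨fun hd => ⟨d.support, hd.1, fun i hi => by simpa using hi⟩,
      fun ⟨s, hs⟩ => reducedExponents_mono n (Set.subset_univ _) hs⟩
  rw [h]
  refine linearIndepOn_iUnion_of_directed ?_ (linearIndepOn_reducedExponents_finset hpow hdisj)
  intro s t
  exact ⟨s ∪ t, reducedExponents_mono n (by simp), reducedExponents_mono n (by simp)⟩

/-- A reduced polynomial is determined by its value at the generators. -/
theorem eq_zero_of_aeval_eq_zero_of_reduced
    (hli : LinearIndepOn K (fun d : ℕ →₀ ℕ => d.prod fun i m => α i ^ m)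
      (reducedExponents n Set.univ)) {p : MvPolynomial ℕ K}
    (hp : p ∈ MvPolynomial.restrictSupport K (reducedExponents n Set.univ))
    (h0 : MvPolynomial.aeval α p = 0) : p = 0 := by
  rw [MvPolynomial.mem_restrictSupport_iff] at hp
  have := linearIndepOn_finset_iff.1 (hli.mono hp) (fun d => p.coeff d) (by
    rw [MvPolynomial.aeval_def, MvPolynomial.eval₂_eq] at h0
    rw [← h0]
    exact Finset.sum_congr rfl fun d _ => by rw [Algebra.smul_def]; rfl)
  ext d
  by_cases hd : d ∈ p.support
  · exact this d hd
  · simpa using hd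

/-- Reduction modulo the polynomials `f i`, each in its own variable. -/
theorem supported_le_reduced_sup {f : ℕ → K[X]} (hmonic : ∀ i, (f i).Monic)
    (hdeg : ∀ i, 0 < (f i).natDegree) (X : Set ℕ) :
    Subalgebra.toSubmodule (MvPolynomial.supported K X) ≤
      MvPolynomial.restrictSupport K (reducedExponents (fun i => (f i).natDegree) X) ⊔
        (Ideal.span (Set.range fun i => aeval (MvPolynomial.X i : MvPolynomial ℕ K) (f i))
          ).restrictScalars K := by
  set T := reducedExponents (fun i => (f i).natDegree) X with hT
  set I := Ideal.span (Set.range fun i => aeval (MvPolynomial.X i : MvPolynomial ℕ K) (f i))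
  set W := MvPolynomial.restrictSupport K T ⊔ I.restrictScalars K with hW
  have hmul : ∀ i ∈ X, ∀ w ∈ W, MvPolynomial.X i * w ∈ W := by
    intro i hi
    suffices W ≤ W.comap (LinearMap.mulLeft K (MvPolynomial.X i)) from this
    refine sup_le ?_ fun w hw => Submodule.mem_sup_right (I.mul_mem_left _ hw)
    rw [MvPolynomial.restrictSupport_eq_span, Submodule.span_le]
    rintro _ ⟨d, hd, rfl⟩
    -- A product of `X i` and a reduced monomial is reduced, or has degree `(f i).natDegree` in
    -- `X i` and is rewritten by means of `f i`.
    show MvPolynomial.X i * MvPolynomial.monomial d 1 ∈ W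
    set m : MvPolynomial ℕ K := MvPolynomial.monomial (d.erase i) 1 with hm
    have hXm : ∀ k, m * MvPolynomial.X i ^ k =
        MvPolynomial.monomial (d.erase i + Finsupp.single i k) 1 := by
      intro k
      rw [MvPolynomial.X_pow_eq_monomial, hm, MvPolynomial.monomial_mul, one_mul]
    have hlow : ∀ k < (f i).natDegree, m * MvPolynomial.X i ^ k ∈ W := by
      intro k hk
      refine Submodule.mem_sup_left ?_
      rw [hXm, MvPolynomial.monomial_mem_restrictSupport]
      refine Or.inl ⟨fun j => ?_, fun j hj => ?_⟩
      · by_cases hji : j = i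
        · subst hji; simpa using hk
        · simpa [Finsupp.erase_ne hji, Finsupp.single_apply, Ne.symm hji] using hd.1 j
      · by_cases hji : j = i
        · rwa [hji]
        · refine hd.2 j ?_
          simpa [Finsupp.erase_ne hji, Finsupp.single_apply, Ne.symm hji] using hj
    have hd' : MvPolynomial.X i * MvPolynomial.monomial d 1 =
        m * (MvPolynomial.X i : MvPolynomial ℕ K) ^ (d i + 1) := by
      rw [pow_succ, ← mul_assoc, hXm, Finsupp.erase_add_single, mul_comm]
    rw [hd']
    rcases Nat.lt_or_ge (d i + 1) (f i).natDegree with h | h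
    · exact hlow _ h
    · have hn : d i + 1 = (f i).natDegree := le_antisymm (hd.1 i) h
      have hI : m * aeval (MvPolynomial.X i : MvPolynomial ℕ K) (f i) ∈ W :=
        Submodule.mem_sup_right (I.mul_mem_left _ (Ideal.subset_span ⟨i, rfl⟩))
      have hexp : m * (MvPolynomial.X i : MvPolynomial ℕ K) ^ (f i).natDegree =
          m * aeval (MvPolynomial.X i : MvPolynomial ℕ K) (f i) -
            ∑ k ∈ Finset.range (f i).natDegree,
              (f i).coeff k • (m * MvPolynomial.X i ^ k) := by
        rw [aeval_eq_sum_range, Finset.sum_range_succ, (hmonic i).coeff_natDegree, one_smul,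
          mul_add, Finset.mul_sum]
        simp only [mul_smul_comm]
        ring
      rw [hn, hexp]
      exact Submodule.sub_mem _ hI (Submodule.sum_mem _ fun k hk =>
        Submodule.smul_mem _ _ (hlow k (Finset.mem_range.1 hk)))
  have hone : (1 : MvPolynomial ℕ K) ∈ W := by
    refine Submodule.mem_sup_left ?_
    rw [← MvPolynomial.C_1, ← MvPolynomial.monomial_zero',
      MvPolynomial.monomial_mem_restrictSupport]
    exact Or.inl ⟨fun i => hdeg i, fun i hi => absurd rfl hi⟩
  intro p hp
  have key : ∀ w ∈ W, p * w ∈ W := by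
    rw [Subalgebra.mem_toSubmodule, MvPolynomial.supported] at hp
    induction hp using Algebra.adjoin_induction with
    | mem x hx =>
      obtain ⟨i, hi, rfl⟩ := hx
      exact hmul i hi
    | algebraMap r =>
      intro w hw
      rw [← Algebra.smul_def]
      exact Submodule.smul_mem _ _ hw
    | add x y _ _ hx hy =>
      intro w hw
      rw [add_mul]
      exact Submodule.add_mem _ (hx w hw) (hy w hw)
    | mul x y _ _ hx hy =>
      intro w hw
      rw [mul_assoc]
      exact hx _ (hy w hw)
  simpa using key 1 hone

theorem mem_iSup_adjoin_simple_iff (hint : ∀ i, IsIntegral K (α i)) {X : Set ℕ} {x : E} :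
    x ∈ (⨆ i ∈ X, K⟮α i⟯ : IntermediateField K E) ↔
      ∃ p ∈ MvPolynomial.supported K X, MvPolynomial.aeval α p = x := by
  have h : (⨆ i ∈ X, K⟮α i⟯ : IntermediateField K E) = adjoin K (α '' X) := by
    rw [← Set.biUnion_of_singleton (α '' X), adjoin_iUnion]
    simp only [adjoin_iUnion, iSup_image]
  rw [h, ← mem_toSubalgebra, adjoin_toSubalgebra_of_isAlgebraic fun x hx => by
      obtain ⟨i, -, rfl⟩ := hx; exact (hint i).isAlgebraic]
  rw [MvPolynomial.supported]
  have : α '' X = MvPolynomial.aeval (R := K) α '' (MvPolynomial.X '' X) := by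
    rw [Set.image_image]; simp
  rw [this, ← AlgHom.map_adjoin]
  rfl

variable {f : ℕ → K[X]}

theorem linearIndependent_pow_of_irreducible {g : K[X]} (hmonic : g.Monic) (hirr : Irreducible g)
    {a : E} (ha : aeval a g = 0) :
    LinearIndependent K fun d : Fin g.natDegree => a ^ (d : ℕ) := by
  rw [minpoly.eq_of_irreducible_of_monic hirr ha hmonic]
  exact linearIndependent_pow a

theorem aeval_eq_zero_of_mem_span (hα : ∀ i, aeval (α i) (f i) = 0) {q : MvPolynomial ℕ K}
    (hq : q ∈ Ideal.span (Set.range fun i => aeval (MvPolynomial.X i : MvPolynomial ℕ K) (f i))) :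
    MvPolynomial.aeval α q = 0 := by
  have : Ideal.span (Set.range fun i => aeval (MvPolynomial.X i : MvPolynomial ℕ K) (f i)) ≤
      RingHom.ker (MvPolynomial.aeval (R := K) α) := by
    rw [Ideal.span_le]
    rintro _ ⟨i, rfl⟩
    simp [RingHom.mem_ker, ← aeval_algHom_apply, hα]
  exact this hq

/-- Any polynomial relation between the `α i` holds between arbitrary roots `r i` of the same
irreducible polynomials, by reduction to a reduced polynomial. -/
theorem aeval_eq_zero_of_aeval_eq_zero (hmonic : ∀ i, (f i).Monic)
    (hdeg : ∀ i, 0 < (f i).natDegree) (hα : ∀ i, aeval (α i) (f i) = 0)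
    (hli : LinearIndepOn K (fun d : ℕ →₀ ℕ => d.prod fun i m => α i ^ m)
      (reducedExponents (fun i => (f i).natDegree) Set.univ))
    {r : ℕ → E} (hr : ∀ i, aeval (r i) (f i) = 0) {p : MvPolynomial ℕ K}
    (hp : MvPolynomial.aeval α p = 0) : MvPolynomial.aeval r p = 0 := by
  have hmem := supported_le_reduced_sup hmonic hdeg Set.univ
    (show p ∈ Subalgebra.toSubmodule (MvPolynomial.supported K Set.univ) by simp)
  obtain ⟨q, hq, q', hq', rfl⟩ := Submodule.mem_sup.1 hmem
  rw [map_add, aeval_eq_zero_of_mem_span hα hq', add_zero] at hp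
  rw [eq_zero_of_aeval_eq_zero_of_reduced hli hq hp, zero_add]
  exact aeval_eq_zero_of_mem_span hr hq'

/-- A reduced polynomial takes a value in the compositum over `X` only if its variables are
in `X`. -/
theorem reduced_aeval_mem_iff (hmonic : ∀ i, (f i).Monic)
    (hdeg : ∀ i, 0 < (f i).natDegree) (hα : ∀ i, aeval (α i) (f i) = 0)
    (hli : LinearIndepOn K (fun d : ℕ →₀ ℕ => d.prod fun i m => α i ^ m)
      (reducedExponents (fun i => (f i).natDegree) Set.univ)) {p : MvPolynomial ℕ K}
    (hp : p ∈ MvPolynomial.restrictSupport K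
      (reducedExponents (fun i => (f i).natDegree) Set.univ)) {X : Set ℕ} :
    MvPolynomial.aeval α p ∈ (⨆ i ∈ X, K⟮α i⟯ : IntermediateField K E) ↔
      ∀ d ∈ p.support, ∀ i, d i ≠ 0 → i ∈ X := by
  have hint : ∀ i, IsIntegral K (α i) := fun i => ⟨f i, hmonic i, hα i⟩
  rw [mem_iSup_adjoin_simple_iff hint]
  constructor
  · rintro ⟨p', hp', he⟩
    obtain ⟨q, hq, q', hq', rfl⟩ := Submodule.mem_sup.1 (supported_le_reduced_sup hmonic hdeg X hp')
    rw [map_add, aeval_eq_zero_of_mem_span hα hq', add_zero] at he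
    have hpq : p - q = 0 := eq_zero_of_aeval_eq_zero_of_reduced hli
      (Submodule.sub_mem _ hp (MvPolynomial.restrictSupport_mono K
        (reducedExponents_mono _ (Set.subset_univ X)) hq)) (by rw [map_sub, he, sub_self])
    rw [sub_eq_zero.1 hpq]
    rw [MvPolynomial.mem_restrictSupport_iff] at hq
    exact fun d hd => (hq hd).2
  · intro h
    refine ⟨p, ?_, rfl⟩
    rw [MvPolynomial.mem_supported]
    intro i hi
    obtain ⟨d, hd, hdi⟩ := (MvPolynomial.mem_vars_iff_mem_support i).1 hi
    exact h d hd i (Finsupp.mem_support_iff.1 hdi)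

end ReducedPolynomials

/-! ### Embeddings, roots and coded copies -/

section Embeddings

variable {K E : Type} [Field K] [Field E] [Algebra K E] {f : ℕ → K[X]} {α : ℕ → E}

/-- Stability forces a conjugate of `α i` in the compositum over `X` to generate the same field as
`α i`, and this is impossible for `i ∉ X` by linear disjointness. -/
theorem exists_root_mem_compositum_iff [IsAlgClosure K E] (hmonic : ∀ i, (f i).Monic)
    (hirr : ∀ i, Irreducible (f i)) (hα : ∀ i, aeval (α i) (f i) = 0)
    {M : ℕ → IntermediateField K E} (hM : ∀ i, M i = K⟮α i⟯)
    (hdisj : TotallyLinearlyDisjoint M) (hstable : IsStable M) (X : Set ℕ) (i : ℕ) :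
    (∃ z ∈ compositum M X, aeval z (f i) = 0) ↔ i ∈ X := by
  constructor
  · rintro ⟨z, hz, hroot⟩
    by_contra hi
    have : IsAlgClosed E := IsAlgClosure.isAlgClosed K
    have : Algebra.IsAlgebraic K E := IsAlgClosure.isAlgebraic
    have hmin : minpoly K (α i) = f i :=
      (minpoly.eq_of_irreducible_of_monic (hirr i) (hα i) (hmonic i)).symm
    obtain ⟨φ, hφ⟩ : ∃ φ : E →ₐ[K] E, φ (α i) = z :=
      exists_algHom_of_splits_of_aeval
        (fun s => ⟨Algebra.IsIntegral.isIntegral s, IsAlgClosed.splits _⟩) (by rw [hmin, hroot])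
    have hle : M i ≤ (compositum M X).comap φ := by
      rw [hM, adjoin_simple_le_iff]
      show φ (α i) ∈ compositum M X
      rwa [hφ]
    have hrange : ((φ.comp (⨆ i, M i : IntermediateField K E).val).comp
        (inclusion (le_iSup M i))).fieldRange ≤ compositum M X := by
      rintro _ ⟨x, rfl⟩
      exact hle x.2
    have hMi : M i ≤ compositum M X := by
      rcases hstable (φ.comp (⨆ i, M i : IntermediateField K E).val) i with h | h
      · exact h.symm.le.trans hrange
      · exact absurd (hrange.trans (compositum_le _ X)) h
    have hX : compositum M X ≤ ⨆ j ∈ ({i}ᶜ : Set ℕ), M j :=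
      biSup_mono fun j hj => by rintro rfl; exact hi hj
    obtain ⟨-, h1, h2⟩ := hdisj i
    have hbot : M i = ⊥ := (h2.of_le_right (hMi.trans hX)).eq_bot_of_self
    exact absurd (finrank_eq_one_iff.2 hbot) h1.ne'
  · intro hi
    have hle : M i ≤ compositum M X := le_iSup₂_of_le (f := fun j (_ : j ∈ X) => M j) i hi le_rfl
    refine ⟨α i, hle ?_, hα i⟩
    rw [hM]
    exact mem_adjoin_simple_self K _

/-- Embeddings of `K⟮a⟯` extending a given embedding of `K` correspond to roots. -/
theorem exists_ringHom_adjoin_simple_iff {B : Type*} [Field B] {g : K[X]} (hmonic : g.Monic)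
    (hirr : Irreducible g) {a : E} (ha : aeval a g = 0) (θ : K →+* B) :
    (∃ σ : K⟮a⟯ →+* B, ∀ x, σ (algebraMap K _ x) = θ x) ↔ ∃ z, g.eval₂ θ z = 0 := by
  constructor
  · rintro ⟨σ, hσ⟩
    refine ⟨σ (AdjoinSimple.gen K a), ?_⟩
    have hθ : θ = σ.comp (algebraMap K _) := RingHom.ext fun x => (hσ x).symm
    rw [hθ, ← hom_eval₂, ← aeval_def]
    have : aeval (AdjoinSimple.gen K a) g = 0 := by
      apply (algebraMap K⟮a⟯ E).injective
      rw [← aeval_algebraMap_apply, AdjoinSimple.algebraMap_gen, ha, map_zero]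
    rw [this, map_zero]
  · rintro ⟨z, hz⟩
    let _ : Algebra K B := θ.toAlgebra
    have hint : IsIntegral K a := ⟨g, hmonic, ha⟩
    have hmin : g = minpoly K a := minpoly.eq_of_irreducible_of_monic hirr ha hmonic
    let σ : K⟮a⟯ →ₐ[K] B := (algHomAdjoinIntegralEquiv K hint).symm
      ⟨z, by
        rw [mem_aroots]
        exact ⟨minpoly.ne_zero hint, by rw [← hmin]; exact hz⟩⟩
    exact ⟨σ, fun x => σ.commutes x⟩

end Embeddings

namespace CodedField

/-- The isomorphism of a field with its coded copy. -/
noncomputable def ofInjectiveEquiv {F : Type} [Field F] (ν : F → ℕ) (hν : Function.Injective ν) :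
    F ≃+* ofInjective ν hν :=
  { Equiv.ofInjective ν hν with
    map_mul' := fun x y => by
      change Equiv.ofInjective ν hν (x * y) = Equiv.ofInjective ν hν
        ((Equiv.ofInjective ν hν).symm (Equiv.ofInjective ν hν x) *
          (Equiv.ofInjective ν hν).symm (Equiv.ofInjective ν hν y))
      simp
    map_add' := fun x y => by
      change Equiv.ofInjective ν hν (x + y) = Equiv.ofInjective ν hν
        ((Equiv.ofInjective ν hν).symm (Equiv.ofInjective ν hν x) +
          (Equiv.ofInjective ν hν).symm (Equiv.ofInjective ν hν y))
      simp }

end CodedField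

section Copies

variable {K E : Type} [Field K] [Field E] [Algebra K E] {L : IntermediateField K E} (ν : L ↪ ℕ)

/-- The isomorphism of the base field with its coded copy. -/
noncomputable def codedBaseEquiv : K ≃+* codedBase ν :=
  CodedField.ofInjectiveEquiv _ _

/-- The isomorphism of a subextension with its coded copy. -/
noncomputable def codedCopyEquiv (S : IntermediateField K E) (h : S ≤ L) :
    S ≃+* codedCopy ν S h :=
  CodedField.ofInjectiveEquiv _ _

theorem mem_codedCopy_carrier {S : IntermediateField K E} {h : S ≤ L} {n : ℕ} :
    n ∈ (codedCopy ν S h).carrier ↔ ∃ x : L, (x : E) ∈ S ∧ ν x = n := by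
  constructor
  · rintro ⟨x, rfl⟩
    exact ⟨inclusion h x, x.2, rfl⟩
  · rintro ⟨x, hx, rfl⟩
    exact ⟨⟨x, hx⟩, rfl⟩

theorem codedBase_isSubstructure (S : IntermediateField K E) (h : S ≤ L) :
    (codedBase ν).IsSubstructure (codedCopy ν S h) :=
  ⟨((codedCopyEquiv ν S h).toRingHom.comp (algebraMap K S)).comp
      (codedBaseEquiv ν).symm.toRingHom, fun a => by
    obtain ⟨x, rfl⟩ := (codedBaseEquiv ν).surjective a
    change ((codedCopyEquiv ν S h (algebraMap K S ((codedBaseEquiv ν).symm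
      (codedBaseEquiv ν x))) : codedCopy ν S h) : ℕ) = _
    rw [RingEquiv.symm_apply_apply]
    rfl⟩

/-- The embedding of `K` into a copy `B` of a subextension. -/
noncomputable def baseHom {S : IntermediateField K E} {h : S ≤ L} {B : CodedField}
    (τ : codedCopy ν S h ≃+* B) : K →+* B :=
  (τ.toRingHom.comp (codedCopyEquiv ν S h).toRingHom).comp (algebraMap K S)

theorem embedsOver_codedCopy_iff {T S : IntermediateField K E} {hT : T ≤ L} {h : S ≤ L}
    {B : CodedField} (τ : codedCopy ν S h ≃+* B) :
    CodedField.EmbedsOver (codedBase ν) (codedCopy ν T hT) τ ↔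
      ∃ σ : T →+* B, ∀ x : K, σ (algebraMap K T x) = baseHom ν τ x := by
  have key : ∀ (σ : codedCopy ν T hT →+* B) (x : K),
      (((τ.symm (σ (codedCopyEquiv ν T hT (algebraMap K T x))) : codedCopy ν S h) : ℕ) =
        (codedCopyEquiv ν T hT (algebraMap K T x) : codedCopy ν T hT)) ↔
      σ (codedCopyEquiv ν T hT (algebraMap K T x)) = baseHom ν τ x := by
    intro σ x
    have : ((codedCopyEquiv ν T hT (algebraMap K T x) : codedCopy ν T hT) : ℕ) =
      (codedCopyEquiv ν S h (algebraMap K S x) : codedCopy ν S h) := rfl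
    rw [this, Subtype.coe_inj, RingEquiv.symm_apply_eq]
    rfl
  constructor
  · rintro ⟨σ, hσ⟩
    exact ⟨σ.comp (codedCopyEquiv ν T hT).toRingHom, fun x => (key σ x).1 (hσ _ ⟨x, rfl⟩)⟩
  · rintro ⟨σ, hσ⟩
    refine ⟨σ.comp (codedCopyEquiv ν T hT).symm.toRingHom, fun y hy => ?_⟩
    obtain ⟨x, hx⟩ := hy
    obtain rfl : codedCopyEquiv ν T hT (algebraMap K T x) = y := Subtype.ext hx
    refine (key _ x).2 ?_
    rw [← hσ]
    simp

end Copies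

/-! ### Computability in coded fields -/

namespace CodedField

variable {F G : CodedField}

theorem add_mem_atomicDiagram {a b c : ℕ} :
    Nat.pair 0 (Nat.pair a (Nat.pair b c)) ∈ F.atomicDiagram ↔
      ∃ x y : F, a = x ∧ b = y ∧ c = (x + y : F) := by
  simp [atomicDiagram, Nat.pair_eq_pair]

theorem mul_mem_atomicDiagram {a b c : ℕ} :
    Nat.pair 1 (Nat.pair a (Nat.pair b c)) ∈ F.atomicDiagram ↔
      ∃ x y : F, a = x ∧ b = y ∧ c = (x * y : F) := by
  simp [atomicDiagram, Nat.pair_eq_pair]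

theorem neg_mem_atomicDiagram {a b : ℕ} :
    Nat.pair 2 (Nat.pair a b) ∈ F.atomicDiagram ↔ ∃ x : F, a = x ∧ b = (-x : F) := by
  simp [atomicDiagram, Nat.pair_eq_pair]

theorem inv_mem_atomicDiagram {a b : ℕ} :
    Nat.pair 3 (Nat.pair a b) ∈ F.atomicDiagram ↔ ∃ x : F, a = x ∧ b = (x⁻¹ : F) := by
  simp [atomicDiagram, Nat.pair_eq_pair]

theorem zero_mem_atomicDiagram {a : ℕ} :
    Nat.pair 4 a ∈ F.atomicDiagram ↔ a = (0 : F) := by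
  simp [atomicDiagram, Nat.pair_eq_pair]

theorem one_mem_atomicDiagram {a : ℕ} :
    Nat.pair 5 a ∈ F.atomicDiagram ↔ a = (1 : F) := by
  simp [atomicDiagram, Nat.pair_eq_pair]

theorem notMem_atomicDiagram {t a : ℕ} (ht : 6 ≤ t) : Nat.pair t a ∉ F.atomicDiagram := by
  simp only [atomicDiagram, Set.mem_ofPred_eq, Nat.pair_eq_pair, not_or, not_exists, not_and]
  refine ⟨?_, ?_, ?_, ?_, ?_, ?_⟩ <;> intros <;> omega

/-- The `j`-th parameter of the atomic sentence coded by `n`; when there are fewer than three, the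
last one is repeated. -/
def atomArg (n j : ℕ) : ℕ :=
  if n.unpair.1 < 2 then
    if j = 0 then n.unpair.2.unpair.1 else
      if j = 1 then n.unpair.2.unpair.2.unpair.1 else n.unpair.2.unpair.2.unpair.2
  else if n.unpair.1 < 4 then
    if j = 0 then n.unpair.2.unpair.1 else n.unpair.2.unpair.2
  else n.unpair.2

/-- The atomic sentence obtained from the one coded by `n` by applying `g` to its parameters. -/
def atomMap (g : ℕ → ℕ) (n : ℕ) : ℕ :=
  if n.unpair.1 < 2 then
    Nat.pair n.unpair.1 (Nat.pair (g (atomArg n 0)) (Nat.pair (g (atomArg n 1)) (g (atomArg n 2))))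
  else if n.unpair.1 < 4 then
    Nat.pair n.unpair.1 (Nat.pair (g (atomArg n 0)) (g (atomArg n 1)))
  else Nat.pair n.unpair.1 (g (atomArg n 0))

theorem atomArg_le (n j : ℕ) : atomArg n j ≤ n := by
  have h1 := Nat.unpair_right_le n
  have h2 := Nat.unpair_right_le n.unpair.2
  have h3 := Nat.unpair_left_le n.unpair.2
  have h4 := Nat.unpair_right_le n.unpair.2.unpair.2
  have h5 := Nat.unpair_left_le n.unpair.2.unpair.2
  unfold atomArg
  split_ifs <;> omega

theorem computable_atomArg : Computable₂ atomArg := by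
  have u1 : Primrec fun p : ℕ × ℕ => p.1.unpair.1 :=
    Primrec.fst.comp (Primrec.unpair.comp Primrec.fst)
  have u2 : Primrec fun p : ℕ × ℕ => p.1.unpair.2 :=
    Primrec.snd.comp (Primrec.unpair.comp Primrec.fst)
  have u21 := Primrec.fst.comp (Primrec.unpair.comp u2)
  have u22 := Primrec.snd.comp (Primrec.unpair.comp u2)
  have u221 := Primrec.fst.comp (Primrec.unpair.comp u22)
  have u222 := Primrec.snd.comp (Primrec.unpair.comp u22)
  have j0 : PrimrecPred fun p : ℕ × ℕ => p.2 = 0 := Primrec.eq.comp Primrec.snd (Primrec.const 0)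
  have j1 : PrimrecPred fun p : ℕ × ℕ => p.2 = 1 := Primrec.eq.comp Primrec.snd (Primrec.const 1)
  exact (Primrec.ite (Primrec.nat_lt.comp u1 (Primrec.const 2))
    (Primrec.ite j0 u21 (Primrec.ite j1 u221 u222))
    (Primrec.ite (Primrec.nat_lt.comp u1 (Primrec.const 4)) (Primrec.ite j0 u21 u22) u2)).to_comp

theorem computable_atomMap {g : ℕ → ℕ} (hg : Computable g) : Computable (atomMap g) := by
  have u1 : Computable fun n : ℕ => n.unpair.1 := Computable.fst.comp Computable.unpair
  have ga : ∀ j, Computable fun n => g (atomArg n j) := fun j =>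
    hg.comp (computable_atomArg.comp Computable.id (Computable.const j))
  exact Computable.ite (ComputablePred.lt u1 (Computable.const 2))
    (Computable.natPair u1 (Computable.natPair (ga 0) (Computable.natPair (ga 1) (ga 2))))
    (Computable.ite (ComputablePred.lt u1 (Computable.const 4))
      (Computable.natPair u1 (Computable.natPair (ga 0) (ga 1))) (Computable.natPair u1 (ga 0)))

/-- The atomic diagram of a subfield of `G` is determined by its universe and the atomic diagram of
`G`. The map `g` describes the embedding; its values outside the universe do not matter. -/
theorem mem_atomicDiagram_iff_of_ringHom (e : F →+* G) {g : ℕ → ℕ}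
    (hg : ∀ x : F, g x = (e x : G)) (n : ℕ) :
    n ∈ F.atomicDiagram ↔ (∀ j < 3, atomArg n j ∈ F.carrier) ∧ atomMap g n ∈ G.atomicDiagram := by
  obtain ⟨t, u, rfl⟩ : ∃ t u, n = Nat.pair t u := ⟨_, _, (Nat.pair_unpair n).symm⟩
  have hinj : ∀ {x y : F}, ((e x : G) : ℕ) = (e y : G) ↔ (x : ℕ) = y := fun {x y} => by
    rw [Subtype.coe_inj, Subtype.coe_inj, e.injective.eq_iff]
  have h3 (P : ℕ → Prop) : (∀ j < 3, P j) ↔ P 0 ∧ P 1 ∧ P 2 :=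
    ⟨fun h => ⟨h 0 (by simp), h 1 (by simp), h 2 (by simp)⟩, fun h j hj => by
      interval_cases j <;> simp [h]⟩
  rw [h3]
  obtain ⟨u1, u2, hu⟩ : ∃ a b, u = Nat.pair a b := ⟨_, _, (Nat.pair_unpair u).symm⟩
  obtain ⟨u3, u4, hu2⟩ : ∃ a b, u2 = Nat.pair a b := ⟨_, _, (Nat.pair_unpair u2).symm⟩
  rcases Nat.lt_or_ge t 6 with ht | ht
  · interval_cases t
    · subst hu2 hu
      simp only [atomArg, atomMap, Nat.unpair_pair, ↓reduceIte, Nat.reduceEqDiff, one_ne_zero,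
        Nat.ofNat_pos, OfNat.ofNat_ne_zero, add_mem_atomicDiagram]
      constructor
      · rintro ⟨x, y, rfl, rfl, rfl⟩
        exact ⟨⟨x.2, y.2, (x + y).2⟩, e x, e y, by simp [hg], by simp [hg], by simp [hg]⟩
      · rintro ⟨⟨hx, hy, hz⟩, x', y', h1, h2, h3⟩
        refine ⟨⟨_, hx⟩, ⟨_, hy⟩, rfl, rfl, ?_⟩
        have h1' := (hg ⟨_, hx⟩).symm.trans h1
        have h2' := (hg ⟨_, hy⟩).symm.trans h2
        have h3' := (hg ⟨_, hz⟩).symm.trans h3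
        rw [← Subtype.ext h1', ← Subtype.ext h2', ← map_add, hinj] at h3'
        exact h3'
    · subst hu2 hu
      simp only [atomArg, atomMap, Nat.unpair_pair, ↓reduceIte, Nat.reduceEqDiff, one_ne_zero,
        Nat.one_lt_ofNat, OfNat.ofNat_ne_zero, mul_mem_atomicDiagram]
      constructor
      · rintro ⟨x, y, rfl, rfl, rfl⟩
        exact ⟨⟨x.2, y.2, (x * y).2⟩, e x, e y, by simp [hg], by simp [hg], by simp [hg]⟩
      · rintro ⟨⟨hx, hy, hz⟩, x', y', h1, h2, h3⟩
        refine ⟨⟨_, hx⟩, ⟨_, hy⟩, rfl, rfl, ?_⟩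
        have h1' := (hg ⟨_, hx⟩).symm.trans h1
        have h2' := (hg ⟨_, hy⟩).symm.trans h2
        have h3' := (hg ⟨_, hz⟩).symm.trans h3
        rw [← Subtype.ext h1', ← Subtype.ext h2', ← map_mul, hinj] at h3'
        exact h3'
    · subst hu
      simp only [atomArg, atomMap, Nat.unpair_pair, ↓reduceIte, Nat.reduceLT, one_ne_zero,
        OfNat.ofNat_ne_zero, neg_mem_atomicDiagram]
      constructor
      · rintro ⟨x, rfl, rfl⟩
        exact ⟨⟨x.2, (-x).2, (-x).2⟩, e x, by simp [hg], by simp [hg]⟩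
      · rintro ⟨⟨hx, hy, -⟩, x', h1, h2⟩
        refine ⟨⟨_, hx⟩, rfl, ?_⟩
        have h1' := (hg ⟨_, hx⟩).symm.trans h1
        have h2' := (hg ⟨_, hy⟩).symm.trans h2
        rw [← Subtype.ext h1', ← map_neg, hinj] at h2'
        exact h2'
    · subst hu
      simp only [atomArg, atomMap, Nat.unpair_pair, ↓reduceIte, Nat.reduceLT, one_ne_zero,
        OfNat.ofNat_ne_zero, inv_mem_atomicDiagram]
      constructor
      · rintro ⟨x, rfl, rfl⟩
        exact ⟨⟨x.2, (x⁻¹).2, (x⁻¹).2⟩, e x, by simp [hg], by simp [hg]⟩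
      · rintro ⟨⟨hx, hy, -⟩, x', h1, h2⟩
        refine ⟨⟨_, hx⟩, rfl, ?_⟩
        have h1' := (hg ⟨_, hx⟩).symm.trans h1
        have h2' := (hg ⟨_, hy⟩).symm.trans h2
        rw [← Subtype.ext h1', ← map_inv₀, hinj] at h2'
        exact h2'
    · simp only [atomArg, atomMap, Nat.unpair_pair, ↓reduceIte, Nat.reduceLT,
        zero_mem_atomicDiagram]
      constructor
      · rintro rfl
        exact ⟨⟨(0 : F).2, (0 : F).2, (0 : F).2⟩, by simp [hg]⟩
      · rintro ⟨⟨hx, -, -⟩, h⟩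
        have h' := (hg ⟨_, hx⟩).symm.trans h
        rw [← map_zero e, hinj] at h'
        exact h'
    · simp only [atomArg, atomMap, Nat.unpair_pair, ↓reduceIte, Nat.reduceLT,
        one_mem_atomicDiagram]
      constructor
      · rintro rfl
        exact ⟨⟨(1 : F).2, (1 : F).2, (1 : F).2⟩, by simp [hg]⟩
      · rintro ⟨⟨hx, -, -⟩, h⟩
        have h' := (hg ⟨_, hx⟩).symm.trans h
        rw [← map_one e, hinj] at h'
        exact h'
  · have h2 : ¬ t < 2 := by omega
    have h4 : ¬ t < 4 := by omega
    simp [atomMap, h2, h4, notMem_atomicDiagram ht]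

/-- The element `n` of `F`, or `0` if `n` is not in the universe of `F`. -/
noncomputable def elt (F : CodedField) (n : ℕ) : F :=
  open Classical in if h : n ∈ F.carrier then ⟨n, h⟩ else 0

@[simp] theorem elt_coe (x : F) : F.elt x = x := by simp [elt]

theorem computablePred_mem_carrier (hF : F.IsComputable) :
    ComputablePred fun n : ℕ => n ∈ F.carrier := by
  have hpair : Computable fun n : ℕ => Nat.pair 0 (Nat.pair n (Nat.pair ((0 : F) : ℕ) n)) :=
    Computable.natPair (Computable.const 0) (Computable.natPair Computable.id
      (Computable.natPair (Computable.const _) Computable.id))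
  refine (ComputablePred.comp hF hpair).of_eq fun n => ?_
  rw [add_mem_atomicDiagram]
  constructor
  · rintro ⟨x, y, rfl, -⟩
    exact x.2
  · intro h
    exact ⟨⟨n, h⟩, 0, rfl, rfl, by simp⟩

section ComputableInto

variable {α β : Type*} [Primcodable α] [Primcodable β]

/-- A map from a type of finite objects into a coded field is computable. -/
def ComputableInto (φ : α → F) : Prop := Computable fun a => (φ a : ℕ)

theorem computableInto_const (x : F) : ComputableInto fun _ : α => x := Computable.const _

theorem ComputableInto.comp {φ : β → F} (hφ : ComputableInto φ) {g : α → β} (hg : Computable g) :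
    ComputableInto fun a => φ (g a) :=
  Computable.comp (f := fun b => (φ b : ℕ)) hφ hg

theorem ComputableInto.eq {φ ψ : α → F} (hφ : ComputableInto φ) (hψ : ComputableInto ψ) :
    ComputablePred fun a => φ a = ψ a :=
  (ComputablePred.eq hφ hψ).of_eq fun _ => Subtype.coe_inj

theorem ComputableInto.ite {φ ψ : α → F} (hφ : ComputableInto φ) (hψ : ComputableInto ψ)
    {p : α → Prop} [DecidablePred p] (hp : ComputablePred p) :
    ComputableInto fun a => if p a then φ a else ψ a :=
  (Computable.ite hp hφ hψ).of_eq fun a => by dsimp only; split_ifs <;> rfl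

theorem computableInto_elt (hF : F.IsComputable) : ComputableInto F.elt := by
  classical
  refine (Computable.ite (computablePred_mem_carrier hF) Computable.id
    (Computable.const ((0 : F) : ℕ))).of_eq fun n => ?_
  by_cases h : n ∈ F.carrier <;> simp [elt, h]

theorem ComputableInto.of_partrec {φ : F → G} (hφ : IsComputableMap φ) {x : α → F}
    (hx : ComputableInto x) : ComputableInto fun a => φ (x a) := by
  obtain ⟨g, hg, h⟩ := hφ
  exact (hg.comp hx).of_eq_tot fun a => h (x a)

/-- The value of an operation whose graph is recorded in the atomic diagram is found by search. -/
theorem ComputableInto.op {φ ψ : α → F} (hφ : ComputableInto φ) (hψ : ComputableInto ψ)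
    {op : F → F → F} {t : ℕ} (hF : F.IsComputable) (hop : ∀ x y : F, ∀ c : ℕ,
      Nat.pair t (Nat.pair x (Nat.pair y c)) ∈ F.atomicDiagram ↔ c = op x y) :
    ComputableInto fun a => op (φ a) (ψ a) := by
  classical
  have hex : ∀ a, ∃ c : ℕ, c = op (φ a) (ψ a) := fun a => ⟨_, rfl⟩
  have hP : ComputablePred fun p : α × ℕ => p.2 = op (φ p.1) (ψ p.1) := by
    refine (ComputablePred.comp hF (f := fun p : α × ℕ =>
      Nat.pair t (Nat.pair (φ p.1) (Nat.pair (ψ p.1) p.2))) ?_).of_eq fun p => hop _ _ _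
    exact Computable.natPair (Computable.const t) (Computable.natPair
      (hφ.comp Computable.fst) (Computable.natPair
        (hψ.comp Computable.fst) Computable.snd))
  exact (Computable.find (P := fun a c => c = op (φ a) (ψ a)) hP hex).of_eq fun a =>
    Nat.find_spec (hex a)

theorem ComputableInto.add (hF : F.IsComputable) {φ ψ : α → F} (hφ : ComputableInto φ)
    (hψ : ComputableInto ψ) : ComputableInto fun a => φ a + ψ a :=
  hφ.op hψ hF (t := 0) fun x y c => by
    rw [add_mem_atomicDiagram]
    exact ⟨by rintro ⟨x', y', h1, h2, rfl⟩; rw [Subtype.ext h1, Subtype.ext h2],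
      fun h => ⟨x, y, rfl, rfl, h⟩⟩

theorem ComputableInto.mul (hF : F.IsComputable) {φ ψ : α → F} (hφ : ComputableInto φ)
    (hψ : ComputableInto ψ) : ComputableInto fun a => φ a * ψ a :=
  hφ.op hψ hF (t := 1) fun x y c => by
    rw [mul_mem_atomicDiagram]
    exact ⟨by rintro ⟨x', y', h1, h2, rfl⟩; rw [Subtype.ext h1, Subtype.ext h2],
      fun h => ⟨x, y, rfl, rfl, h⟩⟩

theorem computableInto_rec {g : α → F} {step : α → ℕ → F → F} {m : α → ℕ}
    (hg : ComputableInto g) (hm : Computable m)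
    (hstep : ComputableInto fun q : α × ℕ × ℕ => step q.1 q.2.1 (F.elt q.2.2)) :
    ComputableInto fun a => Nat.rec (motive := fun _ => F) (g a) (step a) (m a) := by
  refine (Computable.nat_rec (h := fun a (y : ℕ × ℕ) => (step a y.1 (F.elt y.2) : ℕ)) hm hg
    (Computable.to₂ hstep)).of_eq fun a => ?_
  dsimp only
  induction m a with
  | zero => rfl
  | succ n ih => simp only [ih, elt_coe]

theorem ComputableInto.sum (hF : F.IsComputable) {φ : α → ℕ → F}
    (hφ : ComputableInto fun q : α × ℕ => φ q.1 q.2) {m : α → ℕ} (hm : Computable m) :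
    ComputableInto fun a => ∑ k ∈ Finset.range (m a), φ a k := by
  have := computableInto_rec (g := fun _ => (0 : F)) (step := fun a k s => s + φ a k)
    (computableInto_const _) hm (ComputableInto.add hF
      ((computableInto_elt hF).comp (Computable.snd.comp Computable.snd))
      (hφ.comp (Computable.fst.pair (Computable.fst.comp Computable.snd))))
  refine Computable.of_eq this fun a => ?_
  dsimp only
  congr 1
  induction m a with
  | zero => simp
  | succ n ih => simp only [ih, Finset.sum_range_succ]

theorem ComputableInto.prod (hF : F.IsComputable) {φ : α → ℕ → F}
    (hφ : ComputableInto fun q : α × ℕ => φ q.1 q.2) {m : α → ℕ} (hm : Computable m) :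
    ComputableInto fun a => ∏ k ∈ Finset.range (m a), φ a k := by
  have := computableInto_rec (g := fun _ => (1 : F)) (step := fun a k s => s * φ a k)
    (computableInto_const _) hm (ComputableInto.mul hF
      ((computableInto_elt hF).comp (Computable.snd.comp Computable.snd))
      (hφ.comp (Computable.fst.pair (Computable.fst.comp Computable.snd))))
  refine Computable.of_eq this fun a => ?_
  dsimp only
  congr 1
  induction m a with
  | zero => simp
  | succ n ih => simp only [ih, Finset.prod_range_succ]

theorem ComputableInto.pow (hF : F.IsComputable) {φ : α → F} (hφ : ComputableInto φ) {m : α → ℕ}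
    (hm : Computable m) : ComputableInto fun a => φ a ^ m a := by
  have := ComputableInto.prod hF (φ := fun a _ => φ a) (hφ.comp Computable.fst) hm
  simpa using this

end ComputableInto

end CodedField

/-! ### Naming reduced polynomials by numbers -/

section Names

open CodedField

variable {K Kt : CodedField} [Algebra K Kt]

theorem computable_natDegree {f : ℕ → K[X]} (hf : IsComputablePolySeq f) :
    Computable fun i => (f i).natDegree := by
  refine (Computable.pred.comp (Computable.list_length.comp hf)).of_eq fun i => ?_
  simp

theorem computableInto_coeff {f : ℕ → K[X]} (hf : IsComputablePolySeq f) :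
    ComputableInto fun q : ℕ × ℕ => (f q.1).coeff q.2 := by
  have h := (Primrec.list_getD ((0 : K) : ℕ)).to_comp.comp
    (Computable.comp hf Computable.fst) (Computable.snd (α := ℕ) (β := ℕ))
  refine Computable.of_eq h fun q => ?_
  rcases Nat.lt_or_ge q.2 ((f q.1).natDegree + 1) with hq | hq
  · simp [List.getD, hq]
  · rw [List.getD_eq_default _ _ (by simpa using hq)]
    dsimp only
    rw [coeff_eq_zero_of_natDegree_lt (Nat.lt_of_succ_le hq)]

/-- Some root of `f i` in an algebraically closed field is found by search; no splitting algorithm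
is needed. -/
theorem exists_computableInto_root [IsAlgClosed Kt] (hKt : Kt.IsComputable)
    (hemb : IsComputableMap (algebraMap K Kt)) {f : ℕ → K[X]} (hf : IsComputablePolySeq f)
    (hirr : ∀ i, Irreducible (f i)) :
    ∃ r : ℕ → Kt, ComputableInto r ∧ ∀ i, aeval (r i) (f i) = 0 := by
  classical
  have hex : ∀ i, ∃ z : ℕ, aeval (Kt.elt z) (f i) = 0 := fun i => by
    obtain ⟨z, hz⟩ := IsAlgClosed.exists_aeval_eq_zero Kt (f i) (hirr i).degree_pos.ne'
    exact ⟨z, by rwa [elt_coe]⟩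
  have hev : ComputableInto fun q : ℕ × ℕ => aeval (Kt.elt q.2) (f q.1) := by
    have h : ComputableInto fun q : ℕ × ℕ => ∑ k ∈ Finset.range ((f q.1).natDegree + 1),
        algebraMap K Kt ((f q.1).coeff k) * Kt.elt q.2 ^ k :=
      ComputableInto.sum hKt (ComputableInto.mul hKt
        (ComputableInto.of_partrec hemb ((computableInto_coeff hf).comp
          ((Computable.fst.comp Computable.fst).pair Computable.snd)))
        (ComputableInto.pow hKt ((computableInto_elt hKt).comp
          (Computable.snd.comp Computable.fst)) Computable.snd))
        (Computable.succ.comp ((computable_natDegree hf).comp Computable.fst))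
    refine Computable.of_eq h fun q => ?_
    dsimp only
    rw [aeval_eq_sum_range]
    simp only [Algebra.smul_def]
  refine ⟨fun i => Kt.elt (Nat.find (hex i)), (computableInto_elt hKt).comp
    (Computable.find (P := fun i z => aeval (Kt.elt z) (f i) = 0)
      (hev.eq (computableInto_const 0)) hex), fun i => Nat.find_spec (hex i)⟩

/-- The exponent of the monomial with number `k`: its values are the entries of the sequence coded
by `k`. Different numbers may give the same monomial. -/
noncomputable def exponentOf (k : ℕ) : ℕ →₀ ℕ :=
  Finsupp.onFinset (Finset.range k) (seqEntry k) fun i hi => by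
    by_contra h
    exact hi (seqEntry_eq_zero (by simpa using h))

theorem exponentOf_apply (k i : ℕ) : exponentOf k i = seqEntry k i := rfl

/-- `k` is the least number of its monomial, and the exponent of the `i`-th variable in this
monomial is less than `n i`. Only the entries below `k` are inspected, since the others vanish. -/
def IsMonomialNumber (n : ℕ → ℕ) (k : ℕ) : Prop :=
  (∀ i < k, seqEntry k i < n i) ∧ ∀ k' < k, ∃ i < k, seqEntry k' i ≠ seqEntry k i

theorem computablePred_isMonomialNumber {n : ℕ → ℕ} (hn : Computable n) :
    ComputablePred (IsMonomialNumber n) := by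
  refine ComputablePred.and (ComputablePred.forall_lt (p := fun k i => seqEntry k i < n i)
    (ComputablePred.lt computable_seqEntry (hn.comp Computable.snd)) Computable.id) ?_
  refine ComputablePred.forall_lt (p := fun k k' => ∃ i < k, seqEntry k' i ≠ seqEntry k i)
    (ComputablePred.exists_lt (p := fun (q : ℕ × ℕ) i => seqEntry q.2 i ≠ seqEntry q.1 i)
      (ComputablePred.not (ComputablePred.eq ?_ ?_)) Computable.fst) Computable.id
  · exact computable_seqEntry.comp (Computable.snd.comp Computable.fst) Computable.snd
  · exact computable_seqEntry.comp (Computable.fst.comp Computable.fst) Computable.snd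

theorem IsMonomialNumber.mem_reducedExponents {n : ℕ → ℕ} (hn : ∀ i, 0 < n i) {k : ℕ}
    (hk : IsMonomialNumber n k) : exponentOf k ∈ reducedExponents n Set.univ := by
  refine ⟨fun i => ?_, fun _ _ => trivial⟩
  rcases Nat.lt_or_ge i k with h | h
  · exact hk.1 i h
  · rw [exponentOf_apply, seqEntry_eq_zero h]
    exact hn i

theorem IsMonomialNumber.eq_of_exponentOf_eq {n : ℕ → ℕ} {k k' : ℕ}
    (hk : IsMonomialNumber n k) (hk' : IsMonomialNumber n k') (h : exponentOf k = exponentOf k') :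
    k = k' := by
  rcases lt_trichotomy k k' with h' | h' | h'
  · obtain ⟨i, -, hi⟩ := hk'.2 k h'
    exact absurd (DFunLike.congr_fun h i) hi
  · exact h'
  · obtain ⟨i, -, hi⟩ := hk.2 k' h'
    exact absurd (DFunLike.congr_fun h.symm i) hi

theorem exists_isMonomialNumber {n : ℕ → ℕ} {d : ℕ →₀ ℕ}
    (hd : d ∈ reducedExponents n Set.univ) : ∃ k, IsMonomialNumber n k ∧ exponentOf k = d := by
  classical
  have hex : ∃ k, exponentOf k = d := by
    obtain ⟨k, hk⟩ := exists_seqEntry_eq d (d.support.sup id + 1)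
    refine ⟨k, Finsupp.ext fun i => ?_⟩
    rw [exponentOf_apply, hk]
    split_ifs with h
    · rfl
    · by_contra hne
      exact h (Nat.lt_succ_of_le (Finset.le_sup (f := id)
        (Finsupp.mem_support_iff.2 (Ne.symm hne))))
  refine ⟨Nat.find hex, ⟨fun i _ => ?_, fun k' hk' => ?_⟩, Nat.find_spec hex⟩
  · rw [← exponentOf_apply, Nat.find_spec hex]
    exact hd.1 i
  · by_contra! hall
    refine Nat.find_min hex hk' ?_
    rw [← Nat.find_spec hex]
    ext i
    rcases Nat.lt_or_ge i (Nat.find hex) with h | h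
    · exact hall i h
    · rw [exponentOf_apply, exponentOf_apply, seqEntry_eq_zero h,
        seqEntry_eq_zero (hk'.le.trans h)]

/-- The coefficient of the monomial with number `k` in the polynomial with number `c`. The entry `0`
stands for the coefficient `0`, so that almost all coefficients vanish. -/
noncomputable def coeffOf (K : CodedField) (c k : ℕ) : K :=
  if seqEntry c k = 0 then 0 else K.elt (seqEntry c k - 1)

theorem computableInto_coeffOf (hK : K.IsComputable) :
    ComputableInto fun q : ℕ × ℕ => coeffOf K q.1 q.2 :=
  ComputableInto.ite (computableInto_const 0)
    ((computableInto_elt hK).comp (Computable.pred.comp computable_seqEntry))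
    (ComputablePred.eq computable_seqEntry (Computable.const 0))

theorem coeffOf_eq_zero {c k : ℕ} (h : c ≤ k) : coeffOf K c k = 0 := by
  simp [coeffOf, seqEntry_eq_zero h]

open Classical in
/-- The polynomial with number `c`. -/
noncomputable def polyOf (K : CodedField) (n : ℕ → ℕ) (c : ℕ) : MvPolynomial ℕ K :=
  ∑ k ∈ Finset.range c,
    if IsMonomialNumber n k then MvPolynomial.monomial (exponentOf k) (coeffOf K c k) else 0

theorem coeff_polyOf {n : ℕ → ℕ} {c k : ℕ} (hk : IsMonomialNumber n k) :
    (polyOf K n c).coeff (exponentOf k) = coeffOf K c k := by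
  classical
  rw [polyOf, MvPolynomial.coeff_sum, Finset.sum_eq_single k]
  · simp [hk]
  · intro k' _ hne
    split_ifs with h
    · rw [MvPolynomial.coeff_monomial, if_neg fun he => hne (h.eq_of_exponentOf_eq hk he)]
    · simp
  · intro h
    rw [Finset.mem_range, not_lt] at h
    simp [coeffOf_eq_zero h]

theorem polyOf_mem_restrictSupport {n : ℕ → ℕ} (hn : ∀ i, 0 < n i) (c : ℕ) :
    polyOf K n c ∈ MvPolynomial.restrictSupport K (reducedExponents n Set.univ) := by
  refine Submodule.sum_mem _ fun k _ => ?_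
  split_ifs with h
  · exact (MvPolynomial.monomial_mem_restrictSupport K).2 (Or.inl (h.mem_reducedExponents hn))
  · exact Submodule.zero_mem _

theorem forall_mem_support_polyOf {n : ℕ → ℕ} (hn : ∀ i, 0 < n i) {c : ℕ}
    {P : (ℕ →₀ ℕ) → Prop} : (∀ d ∈ (polyOf K n c).support, P d) ↔
      ∀ k < c, IsMonomialNumber n k → coeffOf K c k ≠ 0 → P (exponentOf k) := by
  constructor
  · intro h k _ hk hne
    exact h _ (by rwa [MvPolynomial.mem_support_iff, coeff_polyOf hk])
  · intro h d hd
    obtain ⟨k, hk, rfl⟩ := exists_isMonomialNumber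
      (((MvPolynomial.mem_restrictSupport_iff K).1 (polyOf_mem_restrictSupport hn c)) hd)
    rw [MvPolynomial.mem_support_iff, coeff_polyOf hk] at hd
    exact h k (by by_contra hc; exact hd (coeffOf_eq_zero (not_lt.1 hc))) hk hd

theorem exists_polyOf_eq {n : ℕ → ℕ} (hn : ∀ i, 0 < n i) {p : MvPolynomial ℕ K}
    (hp : p ∈ MvPolynomial.restrictSupport K (reducedExponents n Set.univ)) :
    ∃ c, polyOf K n c = p := by
  classical
  rw [MvPolynomial.mem_restrictSupport_iff] at hp
  choose! num hnum hexp using fun d (hd : d ∈ p.support) => exists_isMonomialNumber (hp hd)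
  obtain ⟨c, hc⟩ := exists_seqEntry_eq (fun k => ((p.coeff (exponentOf k) : K) : ℕ) + 1)
    (p.support.sup num + 1)
  refine ⟨c, MvPolynomial.ext _ _ fun d => ?_⟩
  by_cases hd : d ∈ reducedExponents n Set.univ
  · obtain ⟨k, hk, rfl⟩ := exists_isMonomialNumber hd
    rw [coeff_polyOf hk, coeffOf, hc]
    by_cases h1 : k < p.support.sup num + 1
    · simp [h1]
    · rw [if_neg h1, if_pos rfl]
      by_contra hne
      have hmem := MvPolynomial.mem_support_iff.2 (Ne.symm hne)
      refine h1 (Nat.lt_succ_of_le ?_)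
      rw [hk.eq_of_exponentOf_eq (hnum _ hmem) (hexp _ hmem).symm]
      exact Finset.le_sup hmem
  · rw [MvPolynomial.notMem_support_iff.1 fun h => hd (hp h),
      MvPolynomial.notMem_support_iff.1 fun h => hd
        ((MvPolynomial.mem_restrictSupport_iff K).1 (polyOf_mem_restrictSupport hn c) h)]

theorem computableInto_aeval_polyOf (hK : K.IsComputable) (hKt : Kt.IsComputable)
    (hemb : IsComputableMap (algebraMap K Kt)) {n : ℕ → ℕ} (hn : Computable n) {r : ℕ → Kt}
    (hr : ComputableInto r) :
    ComputableInto fun c => MvPolynomial.aeval r (polyOf K n c) := by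
  classical
  have h : ComputableInto fun c : ℕ => ∑ k ∈ Finset.range c, if IsMonomialNumber n k then
      algebraMap K Kt (coeffOf K c k) * ∏ i ∈ Finset.range k, r i ^ seqEntry k i else 0 := by
    refine ComputableInto.sum hKt (ComputableInto.ite (ComputableInto.mul hKt
      (ComputableInto.of_partrec hemb (computableInto_coeffOf hK))
      (ComputableInto.prod hKt (ComputableInto.pow hKt (hr.comp Computable.snd) ?_)
        Computable.snd)) (computableInto_const 0)
      ((computablePred_isMonomialNumber hn).comp Computable.snd)) Computable.id
    exact computable_seqEntry.comp (Computable.snd.comp Computable.fst) Computable.snd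
  refine Computable.of_eq h fun c => ?_
  dsimp only
  rw [polyOf, map_sum]
  congr 2
  refine funext fun k => ?_
  split_ifs
  · rw [MvPolynomial.aeval_monomial]
    congr 1
    exact (Finsupp.prod_of_support_subset (exponentOf k) Finsupp.support_onFinset_subset
      (fun i m => r i ^ m) fun _ _ => pow_zero _).symm
  · simp

end Names

/-! ### Computable copies of the composita -/

section Presentation

open CodedField

variable {K Kt : CodedField} [Algebra K Kt]

/-- A naming of the elements of `L` by natural numbers which is computable up to an embedding `ψ`
of `L` into `Kt`, and in which the finite set `{i | Q c i}` of generators needed for the element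
with name `c` is computable. -/
structure IsNaming {L : IntermediateField K Kt} (M : ℕ → IntermediateField K Kt) (name : ℕ → L)
    (ψ : L →+* Kt) (Q : ℕ → ℕ → Prop) : Prop where
  surjective : Function.Surjective name
  computable : ComputableInto fun c => ψ (name c)
  map_algebraMap : ∀ x : K, ψ (algebraMap K L x) = algebraMap K Kt x
  computable_support : ComputablePred fun q : ℕ × ℕ => Q q.1 q.2
  lt_of_support : ∀ c i, Q c i → i < c
  mem_compositum_iff : ∀ X c, (name c : Kt) ∈ compositum M X ↔ ∀ i, Q c i → i ∈ X

/-- The names are reduced polynomials, evaluated at the given generators `α i`; the embedding `ψ`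
sends these to roots `r i` of the same polynomials found by search. -/
theorem exists_isNaming [IsAlgClosure K Kt] (hK : K.IsComputable) (hKt : Kt.IsComputable)
    (hemb : IsComputableMap (algebraMap K Kt)) {f : ℕ → K[X]} (hf : IsComputablePolySeq f)
    (hmonic : ∀ i, (f i).Monic) (hirr : ∀ i, Irreducible (f i)) {α : ℕ → Kt}
    (hα : ∀ i, aeval (α i) (f i) = 0) {M : ℕ → IntermediateField K Kt} (hM : ∀ i, M i = K⟮α i⟯)
    (hdisj : TotallyLinearlyDisjoint M) :
    ∃ (name : ℕ → (⨆ i, M i : IntermediateField K Kt))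
      (ψ : (⨆ i, M i : IntermediateField K Kt) →+* Kt) (Q : ℕ → ℕ → Prop),
      IsNaming M name ψ Q := by
  classical
  obtain rfl : M = fun i => K⟮α i⟯ := funext hM
  have : IsAlgClosed Kt := IsAlgClosure.isAlgClosed K
  obtain ⟨r, hr, hroot⟩ := exists_computableInto_root hKt hemb hf hirr
  have hdeg : ∀ i, 0 < (f i).natDegree := fun i => (hirr i).natDegree_pos
  set n : ℕ → ℕ := fun i => (f i).natDegree with hn
  have hncomp : Computable n := computable_natDegree hf
  have hli := linearIndepOn_reducedExponents (n := n)
    (fun i => linearIndependent_pow_of_irreducible (hmonic i) (hirr i) (hα i))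
    fun i => (hdisj i).2.2
  have hmem : ∀ X : Set ℕ, ∀ p ∈ MvPolynomial.restrictSupport K (reducedExponents n Set.univ),
      (MvPolynomial.aeval α p ∈ compositum (fun i => K⟮α i⟯) X ↔
        ∀ d ∈ p.support, ∀ i, d i ≠ 0 → i ∈ X) := fun X p hp =>
    reduced_aeval_mem_iff hmonic hdeg hα hli hp
  have hαL : ∀ i, α i ∈ (⨆ i, K⟮α i⟯ : IntermediateField K Kt) := fun i =>
    le_iSup (fun i => K⟮α i⟯) i (mem_adjoin_simple_self K _)
  let αL : ℕ → (⨆ i, K⟮α i⟯ : IntermediateField K Kt) := fun i => ⟨α i, hαL i⟩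
  have hcoe : ∀ p : MvPolynomial ℕ K, ((MvPolynomial.aeval αL p : (⨆ i, K⟮α i⟯ :
      IntermediateField K Kt)) : Kt) = MvPolynomial.aeval α p := fun p =>
    (MvPolynomial.aeval_algebraMap_apply Kt αL p).symm
  have hint : ∀ i, IsIntegral K (α i) := fun i => ⟨f i, hmonic i, hα i⟩
  have hsurj : Function.Surjective (MvPolynomial.aeval (R := K) αL) := by
    intro x
    have hx : (x : Kt) ∈ (⨆ i ∈ (Set.univ : Set ℕ), K⟮α i⟯ : IntermediateField K Kt) := by
      simp
    obtain ⟨p, -, hp⟩ := (mem_iSup_adjoin_simple_iff hint).1 hx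
    exact ⟨p, Subtype.ext ((hcoe p).trans hp)⟩
  have hker : ∀ p : MvPolynomial ℕ K, MvPolynomial.aeval αL p = 0 →
      MvPolynomial.aeval r p = 0 := fun p hp =>
    aeval_eq_zero_of_aeval_eq_zero hmonic hdeg hα hli hroot (by rw [← hcoe, hp]; rfl)
  let ψ : (⨆ i, K⟮α i⟯ : IntermediateField K Kt) →+* Kt :=
    RingHom.liftOfSurjective (MvPolynomial.aeval (R := K) αL).toRingHom hsurj
      ⟨(MvPolynomial.aeval (R := K) r).toRingHom, fun p hp => hker p hp⟩
  have hψ : ∀ p, ψ (MvPolynomial.aeval αL p) = MvPolynomial.aeval r p := fun p =>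
    RingHom.liftOfRightInverse_comp_apply _ _ _
      ⟨(MvPolynomial.aeval (R := K) r).toRingHom, fun p hp => hker p hp⟩ p
  refine ⟨fun c => MvPolynomial.aeval αL (polyOf K n c), ψ, fun c i => ∃ k < c,
    IsMonomialNumber n k ∧ coeffOf K c k ≠ 0 ∧ seqEntry k i ≠ 0, ?_, ?_, ?_, ?_, ?_, ?_⟩
  · intro x
    obtain ⟨p, rfl⟩ := hsurj x
    obtain ⟨q, hq, q', hq', rfl⟩ := Submodule.mem_sup.1
      (supported_le_reduced_sup hmonic hdeg Set.univ
        (show p ∈ Subalgebra.toSubmodule (MvPolynomial.supported K Set.univ) by simp))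
    obtain ⟨c, rfl⟩ := exists_polyOf_eq hdeg hq
    refine ⟨c, Subtype.ext ?_⟩
    rw [hcoe, hcoe, map_add, aeval_eq_zero_of_mem_span hα hq', add_zero]
  · simp only [hψ]
    exact computableInto_aeval_polyOf hK hKt hemb hncomp hr
  · intro x
    have := hψ (MvPolynomial.C x)
    rwa [MvPolynomial.aeval_C, MvPolynomial.aeval_C] at this
  · refine ComputablePred.exists_lt (p := fun (q : ℕ × ℕ) k => IsMonomialNumber n k ∧
      coeffOf K q.1 k ≠ 0 ∧ seqEntry k q.2 ≠ 0) ?_ Computable.fst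
    refine ((computablePred_isMonomialNumber hncomp).comp Computable.snd).and
      (ComputablePred.and (ComputablePred.not ?_) (ComputablePred.not ?_))
    · exact ((computableInto_coeffOf hK).comp ((Computable.fst.comp Computable.fst).pair
        Computable.snd)).eq (computableInto_const 0)
    · exact ComputablePred.eq (computable_seqEntry.comp Computable.snd
        (Computable.snd.comp Computable.fst)) (Computable.const 0)
  · rintro c i ⟨k, hk, -, -, hi⟩
    by_contra h
    exact hi (seqEntry_eq_zero (hk.le.trans (not_lt.1 h)))
  · intro X c
    rw [hcoe, hmem X _ (polyOf_mem_restrictSupport hdeg c), forall_mem_support_polyOf hdeg]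
    constructor
    · rintro h i ⟨k, hk, hk1, hk2, hi⟩
      exact h k hk hk1 hk2 i hi
    · exact fun h k hk hk1 hk2 i hi => h i ⟨k, hk, hk1, hk2, hi⟩

namespace IsNaming

variable {L : IntermediateField K Kt} {M : ℕ → IntermediateField K Kt} {name : ℕ → L}
  {ψ : L →+* Kt} {Q : ℕ → ℕ → Prop} (h : IsNaming M name ψ Q)

open Classical in
/-- The injection that sends an element to its least name. -/
noncomputable def leastName (h : IsNaming M name ψ Q) : L ↪ ℕ where
  toFun x := Nat.find (h.surjective x)
  inj' x y hxy := by
    rw [← Nat.find_spec (h.surjective x), ← Nat.find_spec (h.surjective y)]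
    exact congrArg name hxy

include h

theorem name_leastName (x : L) : name (h.leastName x) = x := by
  classical
  exact Nat.find_spec (h.surjective x)

theorem leastName_eq_iff {x : L} {c : ℕ} :
    h.leastName x = c ↔ (∀ c' < c, ψ (name c') ≠ ψ (name c)) ∧ name c = x := by
  classical
  rw [show h.leastName x = Nat.find (h.surjective x) from rfl, Nat.find_eq_iff]
  constructor
  · rintro ⟨rfl, hmin⟩
    exact ⟨fun c' hc' he => hmin c' hc' (ψ.injective he), rfl⟩
  · rintro ⟨hmin, rfl⟩
    exact ⟨rfl, fun c' hc' he => hmin c' hc' (congrArg ψ he)⟩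

theorem computablePred_isLeast :
    ComputablePred fun c => ∀ c' < c, ψ (name c') ≠ ψ (name c) :=
  ComputablePred.forall_lt (p := fun c c' => ψ (name c') ≠ ψ (name c))
    (((h.computable.comp Computable.snd).eq (h.computable.comp Computable.fst)).not) Computable.id

theorem mem_carrier_iff {S : IntermediateField K Kt} (hS : S ≤ L) {c : ℕ} :
    c ∈ (codedCopy h.leastName S hS).carrier ↔
      (∀ c' < c, ψ (name c') ≠ ψ (name c)) ∧ (name c : Kt) ∈ S := by
  rw [mem_codedCopy_carrier]
  constructor
  · rintro ⟨x, hx, hc⟩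
    obtain ⟨h1, rfl⟩ := h.leastName_eq_iff.1 hc
    exact ⟨h1, hx⟩
  · rintro ⟨h1, h2⟩
    exact ⟨name c, h2, h.leastName_eq_iff.2 ⟨h1, rfl⟩⟩

theorem mem_atomicDiagram_iff (X : Set ℕ) (hX : compositum M X ≤ L) (n : ℕ) :
    n ∈ (codedCopy h.leastName (compositum M X) hX).atomicDiagram ↔
      ((∀ j < 3, ∀ c' < atomArg n j, ψ (name c') ≠ ψ (name (atomArg n j))) ∧
        atomMap (fun c => (ψ (name c) : ℕ)) n ∈ Kt.atomicDiagram) ∧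
      ∀ i < n, (∃ j < 3, Q (atomArg n j) i) → i ∈ X := by
  have e := mem_atomicDiagram_iff_of_ringHom
    ((ψ.comp (inclusion hX).toRingHom).comp
      (codedCopyEquiv h.leastName (compositum M X) hX).symm.toRingHom)
    (g := fun c => (ψ (name c) : ℕ)) (fun x => by
      obtain ⟨y, rfl⟩ := (codedCopyEquiv h.leastName (compositum M X) hX).surjective x
      change (ψ (name (h.leastName (inclusion hX y))) : ℕ) = _
      rw [h.name_leastName]
      simp) n
  rw [e]
  simp only [h.mem_carrier_iff, h.mem_compositum_iff]
  constructor
  · rintro ⟨h1, h2⟩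
    exact ⟨⟨fun j hj => (h1 j hj).1, h2⟩, fun i _ ⟨j, hj, hi⟩ => (h1 j hj).2 i hi⟩
  · rintro ⟨⟨h1, h2⟩, h3⟩
    exact ⟨fun j hj => ⟨h1 j hj, fun i hi => h3 i
      ((h.lt_of_support _ _ hi).trans_le (atomArg_le n j)) ⟨j, hj, hi⟩⟩, h2⟩

theorem computablePred_atom (hKt : Kt.IsComputable) : ComputablePred fun n : ℕ =>
    (∀ j < 3, ∀ c' < atomArg n j, ψ (name c') ≠ ψ (name (atomArg n j))) ∧
      atomMap (fun c => (ψ (name c) : ℕ)) n ∈ Kt.atomicDiagram := by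
  refine ComputablePred.and (ComputablePred.forall_lt
    (p := fun n j => ∀ c' < atomArg n j, ψ (name c') ≠ ψ (name (atomArg n j)))
    (h.computablePred_isLeast.comp computable_atomArg) (Computable.const 3)) ?_
  exact ComputablePred.comp hKt (computable_atomMap h.computable)

theorem computablePred_support : ComputablePred fun q : ℕ × ℕ =>
    ∃ j < 3, Q (atomArg q.1 j) q.2 :=
  ComputablePred.exists_lt (p := fun (q : ℕ × ℕ) j => Q (atomArg q.1 j) q.2)
    (h.computable_support.comp ((computable_atomArg.comp (Computable.fst.comp Computable.fst)
      Computable.snd).pair (Computable.snd.comp Computable.fst))) (Computable.const 3)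

theorem setTuringLE (hKt : Kt.IsComputable) (X : Set ℕ) (hX : compositum M X ≤ L) :
    SetTuringLE (codedCopy h.leastName (compositum M X) hX).atomicDiagram X := by
  have := setTuringLE_of_forall_lt (X := X) (h.computablePred_atom hKt)
    (Q := fun n i => ∃ j < 3, Q (atomArg n j) i) h.computablePred_support
  rwa [← Set.ext fun n => h.mem_atomicDiagram_iff X hX n] at this

theorem isComputableSeq (hKt : Kt.IsComputable) (hM : ∀ i, M i ≤ L) :
    IsComputableSeq fun i => codedCopy h.leastName (M i) (hM i) := by
  have hsing : ∀ i, compositum M {i} = M i := fun i => by simp [compositum]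
  have key : ∀ (i n : ℕ), n ∈ (codedCopy h.leastName (M i) (hM i)).atomicDiagram ↔
      ((∀ j < 3, ∀ c' < atomArg n j, ψ (name c') ≠ ψ (name (atomArg n j))) ∧
        atomMap (fun c => (ψ (name c) : ℕ)) n ∈ Kt.atomicDiagram) ∧
      ∀ k < n, (∃ j < 3, Q (atomArg n j) k) → k = i := by
    intro i n
    have := h.mem_atomicDiagram_iff {i} ((hsing i).trans_le (hM i)) n
    simp only [hsing] at this
    exact this
  refine ComputablePred.of_eq (p := fun q : ℕ × ℕ => _) ?_ fun q => (key q.1 q.2).symm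
  refine ((h.computablePred_atom hKt).comp Computable.snd).and
    (ComputablePred.forall_lt (p := fun (q : ℕ × ℕ) k => (∃ j < 3, Q (atomArg q.2 j) k) → k = q.1)
      (ComputablePred.imp (h.computablePred_support.comp
        ((Computable.snd.comp Computable.fst).pair Computable.snd)) ?_) Computable.snd)
  exact ComputablePred.eq Computable.snd (Computable.fst.comp Computable.fst)

theorem exists_partrec_algebraMap (hK : K.IsComputable)
    (hemb : IsComputableMap (algebraMap K Kt)) :
    ∃ g : ℕ →. ℕ, Partrec g ∧ ∀ x : K, h.leastName (algebraMap K L x) ∈ g (x : ℕ) := by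
  classical
  have hex : ∀ a : ℕ, ∃ c, ψ (name c) = algebraMap K Kt (K.elt a) := fun a => by
    obtain ⟨c, hc⟩ := h.surjective (algebraMap K L (K.elt a))
    exact ⟨c, by rw [hc, h.map_algebraMap]⟩
  have hcomp := Computable.find (P := fun a c => ψ (name c) = algebraMap K Kt (K.elt a))
    ((h.computable.comp Computable.snd).eq (ComputableInto.of_partrec hemb
      ((computableInto_elt hK).comp Computable.fst))) hex
  refine ⟨_, hcomp.partrec, fun x => ?_⟩
  rw [PFun.coe_val, Part.mem_some_iff, h.leastName_eq_iff]
  have hs := Nat.find_spec (hex x)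
  refine ⟨fun c' hc' he => Nat.find_min (hex x) hc' (he.trans hs), ψ.injective ?_⟩
  rw [hs, elt_coe, h.map_algebraMap]

end IsNaming

end Presentation

/-! ### Enumerating the roots in an isomorphic copy -/

section Derivations

/-- `x` is one of the elements of `G`, or is obtained by one subtraction or division from elements
of `l`. -/
def IsDerivedFrom {F : Type*} [Field F] (G : List F) (l : List F) (x : F) : Prop :=
  x ∈ G ∨ ∃ a ∈ l, ∃ b ∈ l, x + b = a ∨ (b ≠ 0 ∧ x * b = a)

/-- Each element of the list is obtained by one step from the elements after it. -/
inductive IsDerivation {F : Type*} [Field F] (G : List F) : List F → Prop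
  | nil : IsDerivation G []
  | cons {x : F} {l : List F} : IsDerivation G l → IsDerivedFrom G l x → IsDerivation G (x :: l)

variable {F : Type*} [Field F] {G : List F}

theorem IsDerivation.append {l l' : List F} (h : IsDerivation G l) (h' : IsDerivation G l') :
    IsDerivation G (l ++ l') := by
  induction h with
  | nil => exact h'
  | cons _ hx ih =>
    refine ih.cons (hx.imp_right ?_)
    rintro ⟨a, ha, b, hb, h⟩
    exact ⟨a, by simp [ha], b, by simp [hb], h⟩

theorem IsDerivation.getElem {l : List F} (h : IsDerivation G l) (k : ℕ) (hk : k < l.length) :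
    l[k] ∈ G ∨ ∃ (a b : ℕ) (ha : a < l.length) (hb : b < l.length), k < a ∧ k < b ∧
      (l[k] + l[b] = l[a] ∨ (l[b] ≠ 0 ∧ l[k] * l[b] = l[a])) := by
  induction h generalizing k with
  | nil => simp at hk
  | @cons x l _ hx ih =>
    cases k with
    | zero =>
      refine hx.imp_right ?_
      rintro ⟨a, ha, b, hb, h⟩
      obtain ⟨i, hi, rfl⟩ := List.getElem_of_mem ha
      obtain ⟨j, hj, rfl⟩ := List.getElem_of_mem hb
      exact ⟨i + 1, j + 1, by simpa using hi, by simpa using hj, by simp, by simp, by simpa using h⟩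
    | succ k =>
      refine (ih k (by simpa using hk)).imp_right ?_
      rintro ⟨a, b, ha, hb, hka, hkb, h⟩
      exact ⟨a + 1, b + 1, by simpa using ha, by simpa using hb, by omega, by omega,
        by simpa using h⟩

/-- In a field generated by elements of `G`, every element has a derivation from `G`, as subtraction
and division generate the other operations. -/
theorem exists_isDerivation {s : Set F} (hs : Subfield.closure s = ⊤) (hG : ∀ x ∈ s, x ∈ G)
    (h1 : (1 : F) ∈ G) (x : F) : ∃ l, IsDerivation G l ∧ x ∈ l := by
  have step : ∀ {x a b : F}, (∃ l, IsDerivation G l ∧ a ∈ l) → (∃ l, IsDerivation G l ∧ b ∈ l) →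
      (x + b = a ∨ (b ≠ 0 ∧ x * b = a)) → ∃ l, IsDerivation G l ∧ x ∈ l := by
    rintro x a b ⟨l, hl, ha⟩ ⟨l', hl', hb⟩ h
    exact ⟨x :: (l ++ l'), (hl.append hl').cons
      (Or.inr ⟨a, by simp [ha], b, by simp [hb], h⟩), by simp⟩
  have gen : ∀ {x : F}, x ∈ G → ∃ l, IsDerivation G l ∧ x ∈ l := fun {x} hx =>
    ⟨[x], IsDerivation.nil.cons (Or.inl hx), by simp⟩
  have zero : ∃ l, IsDerivation G l ∧ (0 : F) ∈ l := step (gen h1) (gen h1) (Or.inl (zero_add 1))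
  have neg : ∀ {x : F}, (∃ l, IsDerivation G l ∧ x ∈ l) → ∃ l, IsDerivation G l ∧ -x ∈ l :=
    fun hx => step zero hx (Or.inl (by simp))
  have inv : ∀ {x : F}, (∃ l, IsDerivation G l ∧ x ∈ l) → ∃ l, IsDerivation G l ∧ x⁻¹ ∈ l := by
    intro x hx
    by_cases h0 : x = 0
    · simpa [h0] using zero
    · exact step (gen h1) hx (Or.inr ⟨h0, inv_mul_cancel₀ h0⟩)
  have hx : x ∈ Subfield.closure s := hs ▸ Subfield.mem_top x
  induction hx using Subfield.closure_induction with
  | mem x hx => exact gen (hG x hx)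
  | one => exact gen h1
  | add x y _ _ hx hy => exact step hx (neg hy) (Or.inl (by simp))
  | neg x _ hx => exact neg hx
  | inv x _ hx => exact inv hx
  | mul x y _ _ hx hy =>
    by_cases h0 : y = 0
    · simpa [h0] using zero
    · exact step hx (inv hy) (Or.inr ⟨inv_ne_zero h0, by field_simp⟩)

end Derivations

section Roots

open CodedField

variable {K B : CodedField} (θ : K →+* B)

theorem computablePred_mem_list {α : Type*} [Primcodable α] [DecidableEq α] (l : List α) :
    ComputablePred fun a => a ∈ l := by
  induction l with
  | nil => exact ⟨fun _ => .isFalse (by simp), (Computable.const false).of_eq fun a => by simp⟩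
  | cons b l ih =>
    exact ((ComputablePred.eq Computable.id (Computable.const b)).or ih).of_eq fun a => by simp

/-- The entry `k` of the sequence of pairs coded by `D` is obtained by one step from the later
entries, among the first `m`. The step is checked in `K` for the first components and in `B` for
the second ones. -/
def IsPairDerivedAt (G : List (ℕ × ℕ)) (K B : CodedField) (D m k : ℕ) : Prop :=
  (seqEntry D k).unpair ∈ G ∨ ∃ a b t : ℕ, (a < m ∧ b < m ∧ k < a ∧ k < b ∧
    (t = 0 ∨ t = 1 ∧ (seqEntry D b).unpair.1 ≠ (0 : K)) ∧
    Nat.pair t (Nat.pair (seqEntry D k).unpair.1 (Nat.pair (seqEntry D b).unpair.1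
      (seqEntry D a).unpair.1)) ∈ K.atomicDiagram) ∧
    Nat.pair t (Nat.pair (seqEntry D k).unpair.2 (Nat.pair (seqEntry D b).unpair.2
      (seqEntry D a).unpair.2)) ∈ B.atomicDiagram

theorem reIn_isPairDerivedAt (hK : K.IsComputable) (G : List (ℕ × ℕ)) :
    REIn B.atomicDiagram fun q : (ℕ × ℕ) × ℕ => IsPairDerivedAt G K B q.1.1 q.1.2 q.2 := by
  refine REIn.or (REIn.of_computablePred ((computablePred_mem_list G).comp
    (Computable.unpair.comp (computable_seqEntry.comp (Computable.fst.comp Computable.fst)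
      Computable.snd)))) ?_
  refine REIn.ex (REIn.ex (REIn.ex ?_))
  have c0 : Computable fun q : ((((ℕ × ℕ) × ℕ) × ℕ) × ℕ) × ℕ => q.1.1.1 :=
    Computable.fst.comp (Computable.fst.comp Computable.fst)
  have cD : Computable fun q : ((((ℕ × ℕ) × ℕ) × ℕ) × ℕ) × ℕ => q.1.1.1.1.1 :=
    Computable.fst.comp (Computable.fst.comp c0)
  have cm : Computable fun q : ((((ℕ × ℕ) × ℕ) × ℕ) × ℕ) × ℕ => q.1.1.1.1.2 :=
    Computable.snd.comp (Computable.fst.comp c0)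
  have ck : Computable fun q : ((((ℕ × ℕ) × ℕ) × ℕ) × ℕ) × ℕ => q.1.1.1.2 :=
    Computable.snd.comp c0
  have ca : Computable fun q : ((((ℕ × ℕ) × ℕ) × ℕ) × ℕ) × ℕ => q.1.1.2 :=
    Computable.snd.comp (Computable.fst.comp Computable.fst)
  have cb : Computable fun q : ((((ℕ × ℕ) × ℕ) × ℕ) × ℕ) × ℕ => q.1.2 :=
    Computable.snd.comp Computable.fst
  have ct : Computable fun q : ((((ℕ × ℕ) × ℕ) × ℕ) × ℕ) × ℕ => q.2 := Computable.snd
  have fst {u : ((((ℕ × ℕ) × ℕ) × ℕ) × ℕ) × ℕ → ℕ} (hu : Computable u) :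
      Computable fun q : ((((ℕ × ℕ) × ℕ) × ℕ) × ℕ) × ℕ =>
        (seqEntry q.1.1.1.1.1 (u q)).unpair.1 :=
    Computable.fst.comp (Computable.unpair.comp (computable_seqEntry.comp cD hu))
  have snd {u : ((((ℕ × ℕ) × ℕ) × ℕ) × ℕ) × ℕ → ℕ} (hu : Computable u) :
      Computable fun q : ((((ℕ × ℕ) × ℕ) × ℕ) × ℕ) × ℕ =>
        (seqEntry q.1.1.1.1.1 (u q)).unpair.2 :=
    Computable.snd.comp (Computable.unpair.comp (computable_seqEntry.comp cD hu))
  refine REIn.and (REIn.of_computablePred ?_) (REIn.mem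
    (ct.natPair ((snd ck).natPair ((snd cb).natPair (snd ca)))))
  refine (ComputablePred.lt ca cm).and ((ComputablePred.lt cb cm).and ((ComputablePred.lt ck
    ca).and ((ComputablePred.lt ck cb).and (ComputablePred.and ?_ (ComputablePred.comp hK
      (ct.natPair ((fst ck).natPair ((fst cb).natPair (fst ca)))))))))
  exact (ComputablePred.eq ct (Computable.const 0)).or ((ComputablePred.eq ct
    (Computable.const 1)).and (ComputablePred.eq (fst cb) (Computable.const _)).not)

/-- An embedding of a finitely generated computable field into `B` has a graph recursively
enumerable in `B`: its values are computed along derivations from the generators. -/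
theorem reIn_graph (hK : K.IsComputable) (hfg : Field.FG K) :
    REIn B.atomicDiagram fun q : ℕ × ℕ => ∃ x : K, (x : ℕ) = q.1 ∧ (θ x : ℕ) = q.2 := by
  classical
  obtain ⟨s, hs⟩ := (Field.fg_iff K).1 hfg
  set gens : List K := 1 :: s.toList
  set G : List (ℕ × ℕ) := gens.map fun x : K => ((x : ℕ), (θ x : ℕ))
  -- `D` codes the entries of a derivation in `K` paired with their images, and `m` is its length.
  have hRE : REIn B.atomicDiagram fun q : ℕ × ℕ => ∃ D m : ℕ,
      (∀ k < m, IsPairDerivedAt G K B D m k) ∧ ∃ k < m, (seqEntry D k).unpair = q := by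
    refine REIn.ex (REIn.ex (REIn.and ?_ (REIn.of_computablePred ?_)))
    · refine REIn.forall_lt (p := fun (q : ((ℕ × ℕ) × ℕ) × ℕ) k =>
        IsPairDerivedAt G K B q.1.2 q.2 k) ((reIn_isPairDerivedAt hK G).comp
          (f := fun q : (((ℕ × ℕ) × ℕ) × ℕ) × ℕ => ((q.1.1.2, q.1.2), q.2)) ?_) Computable.snd
      exact ((Computable.snd.comp (Computable.fst.comp Computable.fst)).pair
        (Computable.snd.comp Computable.fst)).pair Computable.snd
    · refine ComputablePred.exists_lt (p := fun (q : ((ℕ × ℕ) × ℕ) × ℕ) k =>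
        (seqEntry q.1.2 k).unpair = q.1.1) (ComputablePred.eq ?_ ?_) Computable.snd
      · exact Computable.unpair.comp (computable_seqEntry.comp
          (Computable.snd.comp (Computable.fst.comp Computable.fst)) Computable.snd)
      · exact Computable.fst.comp (Computable.fst.comp Computable.fst)
  refine hRE.of_iff fun q => ?_
  constructor
  · rintro ⟨x, hx1, hx2⟩
    obtain ⟨l, hl, hxl⟩ := exists_isDerivation (G := gens) hs (fun y hy => by
      simp [gens, Finset.mem_coe.1 hy])
      (by simp [gens]) x
    obtain ⟨D, hD⟩ := exists_seqEntry_eq (fun k => Nat.pair (l.getD k 0) (θ (l.getD k 0))) l.length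
    have hent : ∀ k (hk : k < l.length),
        (seqEntry D k).unpair = ((l[k] : ℕ), (θ l[k] : ℕ)) := fun k hk => by
      simp [hD, hk]
    refine ⟨D, l.length, fun k hk => ?_, ?_⟩
    · rw [IsPairDerivedAt, hent k hk]
      refine (hl.getElem k hk).imp (fun h => List.mem_map.2 ⟨_, h, rfl⟩) ?_
      rintro ⟨a, b, ha, hb, hka, hkb, h | ⟨h0, h⟩⟩
      · refine ⟨a, b, 0, ⟨ha, hb, hka, hkb, Or.inl rfl, ?_⟩, ?_⟩
        · rw [hent a ha, hent b hb, add_mem_atomicDiagram]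
          exact ⟨l[k], l[b], rfl, rfl, by rw [h]⟩
        · rw [hent a ha, hent b hb, add_mem_atomicDiagram]
          exact ⟨θ l[k], θ l[b], rfl, rfl, by rw [← map_add, h]⟩
      · refine ⟨a, b, 1, ⟨ha, hb, hka, hkb, Or.inr ⟨rfl, ?_⟩, ?_⟩, ?_⟩
        · rw [hent b hb]
          exact fun h' => h0 (Subtype.ext h')
        · rw [hent a ha, hent b hb, mul_mem_atomicDiagram]
          exact ⟨l[k], l[b], rfl, rfl, by rw [h]⟩
        · rw [hent a ha, hent b hb, mul_mem_atomicDiagram]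
          exact ⟨θ l[k], θ l[b], rfl, rfl, by rw [← map_mul, h]⟩
    · obtain ⟨k, hk, rfl⟩ := List.getElem_of_mem hxl
      exact ⟨k, hk, (hent k hk).trans (Prod.ext hx1 hx2)⟩
  · rintro ⟨D, m, hstep, k, hk, hkq⟩
    have key : ∀ d k, k < m → m - k = d → ∃ x : K, (x : ℕ) = (seqEntry D k).unpair.1 ∧
        (θ x : ℕ) = (seqEntry D k).unpair.2 := by
      intro d
      induction d using Nat.strong_induction_on with
      | _ d ih =>
        intro k hk hd
        rcases hstep k hk with h | ⟨a, b, t, ⟨ha, hb, hka, hkb, ht, hKf⟩, hBf⟩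
        · obtain ⟨x, -, hx⟩ := List.mem_map.1 h
          exact ⟨x, congrArg Prod.fst hx, congrArg Prod.snd hx⟩
        · obtain ⟨xa, hxa, hxa'⟩ := ih (m - a) (by omega) a ha rfl
          obtain ⟨xb, hxb, hxb'⟩ := ih (m - b) (by omega) b hb rfl
          rcases ht with rfl | ⟨rfl, h0⟩
          · obtain ⟨u, v, hu, hv, huv⟩ := add_mem_atomicDiagram.1 hKf
            obtain ⟨u', v', hu', hv', huv'⟩ := add_mem_atomicDiagram.1 hBf
            obtain rfl : xb = v := Subtype.ext (hxb.trans hv)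
            obtain rfl : xa = u + xb := Subtype.ext (hxa.trans huv)
            obtain rfl : θ xb = v' := Subtype.ext (hxb'.trans hv')
            have : θ (u + xb) = u' + θ xb := Subtype.ext (hxa'.trans huv')
            rw [map_add, add_left_inj] at this
            exact ⟨u, hu.symm, by rw [this, hu']⟩
          · obtain ⟨u, v, hu, hv, huv⟩ := mul_mem_atomicDiagram.1 hKf
            obtain ⟨u', v', hu', hv', huv'⟩ := mul_mem_atomicDiagram.1 hBf
            obtain rfl : xb = v := Subtype.ext (hxb.trans hv)
            obtain rfl : xa = u * xb := Subtype.ext (hxa.trans huv)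
            obtain rfl : θ xb = v' := Subtype.ext (hxb'.trans hv')
            have : θ (u * xb) = u' * θ xb := Subtype.ext (hxa'.trans huv')
            have hne : θ xb ≠ 0 := (map_ne_zero θ).2 fun h => h0 (by rw [← hxb, h])
            rw [map_mul, mul_left_inj' hne] at this
            exact ⟨u, hu.symm, by rw [this, hu']⟩
    obtain ⟨x, h1, h2⟩ := key _ k hk rfl
    rw [hkq] at h1 h2
    exact ⟨x, h1, h2⟩

/-- The value at `z` of the polynomial whose coefficients are the images of the coefficients of `g`
in degrees `k`, `k + 1`, …. -/
noncomputable def hornerValue (θ : K →+* B) (g : K[X]) (z : B) (k : ℕ) : B :=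
  ∑ j ∈ Finset.range (g.natDegree + 1 - k), θ (g.coeff (k + j)) * z ^ j

theorem hornerValue_zero (g : K[X]) (z : B) : hornerValue θ g z 0 = g.eval₂ θ z := by
  rw [hornerValue, eval₂_eq_sum_range]
  simp

theorem hornerValue_natDegree_succ (g : K[X]) (z : B) :
    hornerValue θ g z (g.natDegree + 1) = 0 := by
  simp [hornerValue]

theorem hornerValue_step (g : K[X]) (z : B) {k : ℕ} (hk : k < g.natDegree + 1) :
    hornerValue θ g z k = θ (g.coeff k) + z * hornerValue θ g z (k + 1) := by
  obtain ⟨m, hm⟩ : ∃ m, g.natDegree + 1 - k = m + 1 := ⟨g.natDegree - k, by omega⟩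
  rw [hornerValue, hornerValue, hm, Finset.sum_range_succ', show g.natDegree + 1 - (k + 1) = m by
    omega, Finset.mul_sum, add_comm]
  congr 1
  · simp
  · refine Finset.sum_congr rfl fun j _ => ?_
    rw [show k + (j + 1) = k + 1 + j by omega]
    ring

/-- The indices `i` for which the image of `f i` has a root in `B` are recursively enumerable in
`B`: a root is verified by Horner's scheme. -/
theorem reIn_exists_root (hK : K.IsComputable) (hfg : Field.FG K) {f : ℕ → K[X]}
    (hf : IsComputablePolySeq f) :
    REIn B.atomicDiagram fun i => ∃ z, (f i).eval₂ θ z = 0 := by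
  -- `H` codes the values of Horner's scheme at `z`, `y` is the image of the `k`-th coefficient, and
  -- `p` is the product of `z` with the previous value.
  have hRE : REIn B.atomicDiagram fun i : ℕ => ∃ z H : ℕ,
      (seqEntry H ((f i).natDegree + 1) = (0 : B) ∧ seqEntry H 0 = (0 : B)) ∧
      ∀ k < (f i).natDegree + 1, ∃ y p : ℕ,
        (∃ x : K, (x : ℕ) = (f i).coeff k ∧ (θ x : ℕ) = y) ∧
        Nat.pair 1 (Nat.pair z (Nat.pair (seqEntry H (k + 1)) p)) ∈ B.atomicDiagram ∧
        Nat.pair 0 (Nat.pair y (Nat.pair p (seqEntry H k))) ∈ B.atomicDiagram := by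
    have hdeg : Computable fun q : (ℕ × ℕ) × ℕ => (f q.1.1).natDegree + 1 :=
      Computable.succ.comp ((computable_natDegree hf).comp (Computable.fst.comp Computable.fst))
    refine REIn.ex (REIn.ex (REIn.and (REIn.of_computablePred (ComputablePred.and
      (ComputablePred.eq (computable_seqEntry.comp Computable.snd hdeg) (Computable.const _))
      (ComputablePred.eq (computable_seqEntry.comp Computable.snd (Computable.const 0))
        (Computable.const _)))) ?_))
    refine REIn.forall_lt (p := fun (q : (ℕ × ℕ) × ℕ) k => ∃ y p : ℕ,
      (∃ x : K, (x : ℕ) = (f q.1.1).coeff k ∧ (θ x : ℕ) = y) ∧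
        Nat.pair 1 (Nat.pair q.1.2 (Nat.pair (seqEntry q.2 (k + 1)) p)) ∈ B.atomicDiagram ∧
        Nat.pair 0 (Nat.pair y (Nat.pair p (seqEntry q.2 k))) ∈ B.atomicDiagram) ?_ hdeg
    refine REIn.ex (REIn.ex ?_)
    have c3 : Computable fun q : ((((ℕ × ℕ) × ℕ) × ℕ) × ℕ) × ℕ => q.1.1.1 :=
      Computable.fst.comp (Computable.fst.comp Computable.fst)
    have ci : Computable fun q : ((((ℕ × ℕ) × ℕ) × ℕ) × ℕ) × ℕ => q.1.1.1.1.1 :=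
      Computable.fst.comp (Computable.fst.comp c3)
    have cz : Computable fun q : ((((ℕ × ℕ) × ℕ) × ℕ) × ℕ) × ℕ => q.1.1.1.1.2 :=
      Computable.snd.comp (Computable.fst.comp c3)
    have cH : Computable fun q : ((((ℕ × ℕ) × ℕ) × ℕ) × ℕ) × ℕ => q.1.1.1.2 :=
      Computable.snd.comp c3
    have ck : Computable fun q : ((((ℕ × ℕ) × ℕ) × ℕ) × ℕ) × ℕ => q.1.1.2 :=
      Computable.snd.comp (Computable.fst.comp Computable.fst)
    have cy : Computable fun q : ((((ℕ × ℕ) × ℕ) × ℕ) × ℕ) × ℕ => q.1.2 :=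
      Computable.snd.comp Computable.fst
    have cp : Computable fun q : ((((ℕ × ℕ) × ℕ) × ℕ) × ℕ) × ℕ => q.2 := Computable.snd
    refine REIn.and ?_ (REIn.and (REIn.mem ((Computable.const 1).natPair (cz.natPair
      ((computable_seqEntry.comp cH (Computable.succ.comp ck)).natPair cp))))
      (REIn.mem ((Computable.const 0).natPair (cy.natPair (cp.natPair
        (computable_seqEntry.comp cH ck))))))
    exact (reIn_graph θ hK hfg).comp
      (((computableInto_coeff hf).comp (ci.pair ck) : Computable _).pair cy)
  refine hRE.of_iff fun i => ?_
  constructor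
  · rintro ⟨z, hz⟩
    obtain ⟨H, hH⟩ := exists_seqEntry_eq (fun k => (hornerValue θ (f i) z k : ℕ))
      ((f i).natDegree + 2)
    have hH' : ∀ k ≤ (f i).natDegree + 1, seqEntry H k = hornerValue θ (f i) z k := fun k hk => by
      rw [hH, if_pos (by omega)]
    refine ⟨z, H, ⟨?_, ?_⟩, fun k hk => ⟨θ ((f i).coeff k),
      (z * hornerValue θ (f i) z (k + 1) : B), ⟨_, rfl, rfl⟩, ?_, ?_⟩⟩
    · rw [hH' _ le_rfl, hornerValue_natDegree_succ]
    · rw [hH' _ (Nat.zero_le _), hornerValue_zero, hz]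
    · rw [mul_mem_atomicDiagram]
      exact ⟨_, _, rfl, hH' _ hk, rfl⟩
    · rw [add_mem_atomicDiagram]
      exact ⟨_, _, rfl, rfl, by rw [hH' _ hk.le, hornerValue_step θ _ _ hk]⟩
  · rintro ⟨z, H, ⟨htop, hbot⟩, hstep⟩
    -- The step at `0` ensures that `z` is in the universe of `B`.
    obtain ⟨zB, rfl⟩ : ∃ zB : B, z = zB := by
      obtain ⟨y, p, -, h, -⟩ := hstep 0 (Nat.succ_pos _)
      obtain ⟨u, -, hu, -⟩ := mul_mem_atomicDiagram.1 h
      exact ⟨u, hu⟩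
    have key : ∀ d k, k + d = (f i).natDegree + 1 →
        seqEntry H k = hornerValue θ (f i) zB k := by
      intro d
      induction d with
      | zero =>
        intro k hk
        rw [add_zero] at hk
        rw [hk, htop, hornerValue_natDegree_succ]
      | succ d ih =>
        intro k hk
        obtain ⟨y, p, ⟨x, hx, hy⟩, hm, ha⟩ := hstep k (by omega)
        obtain ⟨u, v, hu, hv, hp⟩ := mul_mem_atomicDiagram.1 hm
        obtain ⟨y', p', hy', hp', hr⟩ := add_mem_atomicDiagram.1 ha
        obtain rfl : zB = u := Subtype.ext hu
        obtain rfl : hornerValue θ (f i) zB (k + 1) = v :=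
          Subtype.ext ((ih (k + 1) (by omega)).symm.trans hv)
        obtain rfl : x = (f i).coeff k := Subtype.ext hx
        obtain rfl : θ ((f i).coeff k) = y' := Subtype.ext (hy.trans hy')
        obtain rfl : zB * hornerValue θ (f i) zB (k + 1) = p' := Subtype.ext (hp.symm.trans hp')
        rw [hr, hornerValue_step θ (f i) zB (k := k) (by omega)]
    refine ⟨zB, ?_⟩
    rw [← hornerValue_zero]
    exact Subtype.ext ((key _ 0 (zero_add _)).symm.trans hbot)

end Roots

/-! ### The degree conditions -/

section Conditions

variable {K Kt : CodedField} [Algebra K Kt] {f : ℕ → K[X]} {α : ℕ → Kt}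
  {M : ℕ → IntermediateField K Kt}

theorem fg_codedBase (hfg : Field.FG K) {L : IntermediateField K Kt} (ν : L ↪ ℕ) :
    Field.FG (codedBase ν) := by
  classical
  obtain ⟨s, hs⟩ := (Field.fg_iff K).1 hfg
  refine (Field.fg_iff _).2 ⟨s.image (codedBaseEquiv ν), ?_⟩
  have h := RingHom.map_field_closure (codedBaseEquiv ν : K →+* codedBase ν) (s : Set K)
  rw [hs] at h
  rw [Finset.coe_image]
  refine h.symm.trans (top_le_iff.1 fun y _ => ?_)
  exact ⟨(codedBaseEquiv ν).symm y, trivial, (codedBaseEquiv ν).apply_symm_apply y⟩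

theorem embedsOver_iff_exists_root (hmonic : ∀ i, (f i).Monic) (hirr : ∀ i, Irreducible (f i))
    (hα : ∀ i, aeval (α i) (f i) = 0) (hM : ∀ i, M i = K⟮α i⟯) {L : IntermediateField K Kt}
    (ν : L ↪ ℕ) (hL : ∀ i, M i ≤ L) {S : IntermediateField K Kt} {hS : S ≤ L} {B : CodedField}
    (τ : codedCopy ν S hS ≃+* B) (i : ℕ) :
    CodedField.EmbedsOver (codedBase ν) (codedCopy ν (M i) (hL i)) τ ↔
      ∃ z, (f i).eval₂ (baseHom ν τ) z = 0 := by
  rw [embedsOver_codedCopy_iff, ← exists_ringHom_adjoin_simple_iff (hmonic i) (hirr i) (hα i), hM i]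

/-- The set `X` can be recovered from any copy of the compositum over `X`, as the set of the `i` for
which `f i` has a root. -/
theorem exists_root_baseHom_iff [IsAlgClosure K Kt] (hmonic : ∀ i, (f i).Monic)
    (hirr : ∀ i, Irreducible (f i)) (hα : ∀ i, aeval (α i) (f i) = 0)
    (hM : ∀ i, M i = K⟮α i⟯) (hdisj : TotallyLinearlyDisjoint M) (hstable : IsStable M)
    {L : IntermediateField K Kt} (ν : L ↪ ℕ) (X : Set ℕ) {hX : compositum M X ≤ L}
    {B : CodedField} (τ : codedCopy ν (compositum M X) hX ≃+* B) (i : ℕ) :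
    (∃ z, (f i).eval₂ (baseHom ν τ) z = 0) ↔ i ∈ X := by
  rw [← exists_root_mem_compositum_iff hmonic hirr hα hM hdisj hstable X i]
  let e : compositum M X ≃+* B := (codedCopyEquiv ν _ hX).trans τ
  have he : ∀ z : compositum M X, (f i).eval₂ (baseHom ν τ) (e z) = 0 ↔
      aeval (z : Kt) (f i) = 0 := by
    intro z
    have h1 : (f i).eval₂ (baseHom ν τ) (e z) = e (aeval z (f i)) :=
      (hom_eval₂ (f i) (algebraMap K (compositum M X)) (e : compositum M X →+* B) z).symm
    rw [h1, map_eq_zero_iff e e.injective, ← map_eq_zero_iff (algebraMap (compositum M X) Kt)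
      (algebraMap (compositum M X) Kt).injective, ← aeval_algebraMap_apply]
    rfl
  constructor
  · rintro ⟨z, hz⟩
    obtain ⟨z, rfl⟩ := e.surjective z
    exact ⟨z, z.2, (he z).1 hz⟩
  · rintro ⟨z, hz, h⟩
    exact ⟨e ⟨z, hz⟩, (he ⟨z, hz⟩).2 h⟩

end Conditions

/-! ### Realizing all degrees -/

section Degrees

/-- The set `D ⊕ Dᶜ`, in which exactly one of `2 * n` and `2 * n + 1` lies, according to whether
`n ∈ D`. -/
def joinCompl (D : Set ℕ) : Set ℕ :=
  {m | m % 2 = 0 ↔ m / 2 ∈ D}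

theorem two_mul_mem_joinCompl {D : Set ℕ} {n : ℕ} : 2 * n ∈ joinCompl D ↔ n ∈ D := by
  simp [joinCompl]

theorem two_mul_add_one_mem_joinCompl {D : Set ℕ} {n : ℕ} : 2 * n + 1 ∈ joinCompl D ↔ n ∉ D := by
  have : (2 * n + 1) / 2 = n := by omega
  simp [joinCompl, this]

theorem setTuringLE_joinCompl (D : Set ℕ) : SetTuringLE (joinCompl D) D := by
  classical
  have hdiv : Computable fun m : ℕ => m / 2 :=
    Primrec.nat_div.to_comp.comp Computable.id (Computable.const 2)
  have hmod : Computable fun m : ℕ => m % 2 :=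
    Primrec.nat_mod.to_comp.comp Computable.id (Computable.const 2)
  have hchar : Nat.RecursiveIn {charFun D} fun m => Part.some (if m / 2 ∈ D then 1 else 0) :=
    (Nat.RecursiveIn.oracle (charFun D) (Set.mem_singleton _)).comp_some (hdiv.natRecursiveIn _)
  -- `m % 2` and the value of the characteristic function of `D` at `m / 2` must be different.
  have hg : Computable fun q : ℕ => if q.unpair.1 + q.unpair.2 = 1 then 1 else 0 :=
    Computable.ite (ComputablePred.eq (Primrec.nat_add.to_comp.comp
      (Computable.fst.comp Computable.unpair) (Computable.snd.comp Computable.unpair))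
      (Computable.const 1)) (Computable.const 1) (Computable.const 0)
  refine RecursiveIn.iff_nat.2 (((hg.natRecursiveIn _).comp_some
    ((hmod.natRecursiveIn _).pair_some hchar)).of_eq fun m => ?_)
  simp only [charFun, joinCompl, Set.mem_ofPred_eq, Nat.unpair_pair]
  rcases Nat.mod_two_eq_zero_or_one m with h | h <;> by_cases h' : m / 2 ∈ D <;> simp [h, h']

/-- A procedure choosing between `2 * n` and `2 * n + 1` computes `D`. -/
theorem setTuringLE_of_decides {D S : Set ℕ} {P : ℕ × ℕ →. Bool}
    (hP : RecursiveIn {charFun S} P)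
    (h : ∀ n, (n ∈ D → true ∈ P (2 * n, 2 * n + 1)) ∧ (n ∉ D → false ∈ P (2 * n, 2 * n + 1))) :
    SetTuringLE D S := by
  classical
  have hdouble : Computable fun n : ℕ => 2 * n :=
    Primrec.nat_mul.to_comp.comp (Computable.const 2) Computable.id
  have hpair : Computable fun n : ℕ => Nat.pair (2 * n) (2 * n + 1) :=
    Computable.natPair hdouble (Computable.succ.comp hdouble)
  -- The code of `true` is `1` and the code of `false` is `0`.
  have hcode : Nat.RecursiveIn {charFun S} fun m =>
      Part.bind (Encodable.decode m : Option (ℕ × ℕ)) fun q => (P q).map Encodable.encode := hP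
  refine RecursiveIn.iff_nat.2 ((hcode.comp_some (hpair.natRecursiveIn _)).of_eq fun n => ?_)
  by_cases hn : n ∈ D
  · simp [charFun, hn, Part.eq_some_iff.2 ((h n).1 hn)]
  · simp [charFun, hn, Part.eq_some_iff.2 ((h n).2 hn)]

end Degrees

theorem mainTheorem3 (K Kt : CodedField) [Algebra K Kt]
    (hK : K.IsComputable) (hKfg : Field.FG K) (hKt : IsComputableAlgClosure K Kt)
    (f : ℕ → K[X]) (hf : IsComputablePolySeq f)
    (hmonic : ∀ i, (f i).Monic) (hirr : ∀ i, Irreducible (f i))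
    (α : ℕ → Kt) (hα : ∀ i, aeval (α i) (f i) = 0)
    (M : ℕ → IntermediateField K Kt) (hM : ∀ i, M i = K⟮α i⟯)
    (hdisj : TotallyLinearlyDisjoint M) (hstable : IsStable M) :
    (∃ ν : (⨆ i, M i : IntermediateField K Kt) ↪ ℕ,
      (∃ g : ℕ →. ℕ, Partrec g ∧ ∀ x : K, ν (algebraMap K _ x) ∈ g (x : ℕ)) ∧
      DegreeConditions (codedBase ν) (fun i => codedCopy ν (M i) (le_iSup M i))
        (fun X => codedCopy ν (compositum M X) (compositum_le M X))) ∧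
    ∀ D : Set ℕ, ∃ X : Set ℕ, IsoTypeHasDegree (compositum M X) D := by
  obtain ⟨hAC, hKtc, hemb⟩ := hKt
  obtain ⟨name, ψ, Q, h⟩ := exists_isNaming hK hKtc hemb hf hmonic hirr hα hM hdisj
  have hroot (X : Set ℕ) {B : CodedField}
      (τ : codedCopy h.leastName (compositum M X) (compositum_le M X) ≃+* B) (i : ℕ) :=
    exists_root_baseHom_iff hmonic hirr hα hM hdisj hstable h.leastName X τ i
  have hembeds (X : Set ℕ) {B : CodedField}
      (τ : codedCopy h.leastName (compositum M X) (compositum_le M X) ≃+* B) (i : ℕ) :=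
    (embedsOver_iff_exists_root hmonic hirr hα hM h.leastName (le_iSup M) τ i).trans (hroot X τ i)
  have hdecides (X : Set ℕ) (B : CodedField)
      (τ : codedCopy h.leastName (compositum M X) (compositum_le M X) ≃+* B) :
      ∃ P : ℕ × ℕ →. Bool, RecursiveIn {charFun B.atomicDiagram} P ∧ ∀ i j,
        (i ∈ X ∧ j ∉ X → true ∈ P (i, j)) ∧ (j ∈ X ∧ i ∉ X → false ∈ P (i, j)) :=
    ((reIn_exists_root (baseHom h.leastName τ) hK hKfg hf).of_iff
      fun i => (hroot X τ i).symm).exists_recursiveIn_decides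
  refine ⟨⟨h.leastName, h.exists_partrec_algebraMap hK hemb,
    { computable_seq := h.isComputableSeq hKtc _
      fg := fg_codedBase hKfg _
      sub_Ai := fun i => codedBase_isSubstructure _ _ _
      sub_AX := fun X => codedBase_isSubstructure _ _ _
      AX_le := fun X => h.setTuringLE hKtc X _
      embeds_iff := fun X i => hembeds X _ i
      decides := fun X B τ => by simpa only [hembeds X τ] using hdecides X B τ }⟩, fun D => ?_⟩
  refine ⟨joinCompl D, ?_⟩
  have hle (B : CodedField) (e : compositum M (joinCompl D) ≃+* B) :
      SetTuringLE D B.atomicDiagram := by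
    obtain ⟨P, hP, hd⟩ := hdecides (joinCompl D) B
      ((codedCopyEquiv h.leastName _ (compositum_le M _)).symm.trans e)
    refine setTuringLE_of_decides hP fun n => ?_
    simpa [two_mul_mem_joinCompl, two_mul_add_one_mem_joinCompl] using hd (2 * n) (2 * n + 1)
  refine ⟨⟨_, ⟨codedCopyEquiv h.leastName _ (compositum_le M _)⟩,
    (h.setTuringLE hKtc _ _).trans (setTuringLE_joinCompl D), hle _ (codedCopyEquiv _ _ _)⟩, ?_⟩
  rintro B ⟨e⟩
  exact hle B e
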